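/- **Rulesets.** Let $n,a,b\ge 0$ be integers. The single-heap Robin Hood game $(n;a,b)$ (heap size $n$, Left's wealth $a$, Right's wealth $b$) is the normal-play game with Left options $(n-i;\,a,\,\max\{b-i,0\})$ for $1\le i\le \min\{n,a\}$ and Right options $(n-j;\,\max\{a-j,0\},\,b)$ for $1\le j\le\min\{n,b\}$. The Little John game $(n;a,b)^*$ is defined as follows. If $n=0$ or $a=b=0$, nobody has an option. Otherwise, if $a,b>0$, then with $\gamma=\min\{n,a,b\}$ the only Left option is $(n-\gamma;a,b-\gamma)^*$ and the only Right option is $(n-\gamma;a-\gamma,b)^*$; if $a>0=b$, the only Left option is $(n-1;a,0)^*$ and Right has none; if $b>0=a$, the only Right option is $(n-1;0,b)^*$ and Left has none. **Thermographs.** Let $\mathbb D$ be the set of dyadic rationals and $\mathbb D^+=\{p\in\mathbb D: p\ge 0\}$; dyadics are identified with the corresponding number games. For a short game $G$, the Left stop $\ell(G)$ and Right stop $r(G)$ are both $x$ if $G$ equals a dyadic $x$; otherwise $\ell(G)=\max_{G^L} r(G^L)$ and $r(G)=\min_{G^R}\ell(G^R)$. For $G$ in canonical form and $p\in\mathbb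 D^+$, the penalized game $G_p$ is defined recursively: $G_p=\{(G^L)_p-p\mid (G^R)_p+p\}$ for $0\le p\le t$, where $t$ is the least $p\in\mathbb D^+$ for which the Left and Right stops of $\{(G^L)_p-p\mid (G^R)_p+p\}$ are equal, and $G_p=x$ for $p>t$, where $x$ is the common value of the stops of $G_t$. The thermograph $\mathcal T(G)$ of a short game $G$ is the plot of the Left and Right stops of $K_p$ against $p$, $K$ being the canonical form of $G$; that is, it consists of the left wall $\{(\ell(K_p),p):p\in\mathbb D^+\}$ and the right wall $\{(r(K_p),p):p\in\mathbb D^+\}$. **Theorem (Robin Hood Thermographs).** Let $a,b\ge 0$ be integers. Then, for every sufficiently large heap size $n$ (that is, for all $n\ge N$ with some $N$ depending on $a$ and $b$), $$\mathcal T\big((n;a,b)\big)=\mathcal T\big((n;a,b)^*\big).$$ -/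

import Mathlib

/-- Game forms of short (finite, loop-free) two-player partizan games: finite families of Left
options and of Right options.  Normal play: a player who cannot move loses. -/
inductive ShortGame : Type
  | mk {m n : ℕ} (L : Fin m → ShortGame) (R : Fin n → ShortGame) : ShortGame

namespace ShortGame

/-- `G.IsLeftOption H` : the game `H` is a Left option of `G`. -/
def IsLeftOption : ShortGame → ShortGame → Prop
  | mk L _, H => ∃ i, L i = H

/-- `G.IsRightOption H` : the game `H` is a Right option of `G`. -/
def IsRightOption : ShortGame → ShortGame → Prop
  | mk _ R, H => ∃ j, R j = H

/-- The number of nodes of the game tree. -/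
def size : ShortGame → ℕ
  | mk L R => 1 + ∑ i, size (L i) + ∑ j, size (R j)

theorem size_left_lt {m n : ℕ} (L : Fin m → ShortGame) (R : Fin n → ShortGame) (i : Fin m) :
    (L i).size < (mk L R).size := by
  have := Finset.single_le_sum (f := fun i => (L i).size) (fun _ _ => Nat.zero_le _)
    (Finset.mem_univ i)
  simp only [size] at *
  omega

theorem size_right_lt {m n : ℕ} (L : Fin m → ShortGame) (R : Fin n → ShortGame) (j : Fin n) :
    (R j).size < (mk L R).size := by
  have := Finset.single_le_sum (f := fun i => (R i).size) (fun _ _ => Nat.zero_le _)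
    (Finset.mem_univ j)
  simp only [size] at *
  omega

/-- The order of games: `G ≤ H` iff no Left option `G^L` satisfies `H ≤ G^L` and no Right option
`H^R` satisfies `H^R ≤ G`. -/
def Le : ShortGame → ShortGame → Prop
  | mk L R, mk L' R' =>
    (∀ i, ¬ Le (mk L' R') (L i)) ∧ (∀ j, ¬ Le (R' j) (mk L R))
termination_by G H => G.size + H.size
decreasing_by
  · have := size_left_lt L R i
    omega
  · have := size_right_lt L' R' j
    omega

/-- Equality of (the values of) games, as opposed to identity of forms. -/
def Equal (G H : ShortGame) : Prop := Le G H ∧ Le H G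

theorem le_mk_iff {m n m' n' : ℕ} {L : Fin m → ShortGame} {R : Fin n → ShortGame}
    {L' : Fin m' → ShortGame} {R' : Fin n' → ShortGame} :
    Le (mk L R) (mk L' R') ↔
      (∀ i, ¬ Le (mk L' R') (L i)) ∧ (∀ j, ¬ Le (R' j) (mk L R)) := by
  rw [Le]

/-- The canonical forms: in every subposition, no option is dominated by another option of the
same player, and no option is reversible. -/
def IsCanonical : ShortGame → Prop
  | mk L R =>
    (∀ i, IsCanonical (L i)) ∧ (∀ j, IsCanonical (R j)) ∧
    (∀ i i', i ≠ i' → ¬ Le (L i) (L i')) ∧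
    (∀ j j', j ≠ j' → ¬ Le (R j') (R j)) ∧
    (∀ i H, (L i).IsRightOption H → ¬ Le H (mk L R)) ∧
    (∀ j H, (R j).IsLeftOption H → ¬ Le (mk L R) H)

/-! ### Every short game has a canonical form -/

theorem le_refl (G : ShortGame) : Le G G := by
  induction G with
  | mk L R ihL ihR =>
    refine le_mk_iff.2 ⟨fun i h => ?_, fun j h => ?_⟩
    · have h1 := ihL i
      cases hLi : L i with
      | mk A B =>
        rw [hLi] at h h1
        exact (le_mk_iff.1 h).1 i (hLi ▸ h1)
    · have h1 := ihR j
      cases hRj : R j with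
      | mk A B =>
        rw [hRj] at h h1
        exact (le_mk_iff.1 h).2 j (hRj ▸ h1)

theorem not_le_left {m n : ℕ} (L : Fin m → ShortGame) (R : Fin n → ShortGame) (i : Fin m) :
    ¬ Le (mk L R) (L i) := (le_mk_iff.1 (le_refl (mk L R))).1 i

theorem not_right_le {m n : ℕ} (L : Fin m → ShortGame) (R : Fin n → ShortGame) (j : Fin n) :
    ¬ Le (R j) (mk L R) := (le_mk_iff.1 (le_refl (mk L R))).2 j

theorem le_trans : ∀ (G H K : ShortGame), Le G H → Le H K → Le G K
  | mk L R, mk L' R', mk L'' R'', h1, h2 => by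
    refine le_mk_iff.2 ⟨fun i h => ?_, fun j h => ?_⟩
    · exact (le_mk_iff.1 h1).1 i (le_trans _ _ _ h2 h)
    · exact (le_mk_iff.1 h2).2 j (le_trans _ _ _ h h1)
termination_by G H K => G.size + H.size + K.size
decreasing_by
  · have := size_left_lt L R i
    omega
  · have := size_right_lt L'' R'' j
    omega

theorem Equal.refl (G : ShortGame) : Equal G G := ⟨le_refl G, le_refl G⟩

theorem Equal.trans {G H K : ShortGame} (h1 : Equal G H) (h2 : Equal H K) : Equal G K :=
  ⟨le_trans _ _ _ h1.1 h2.1, le_trans _ _ _ h2.2 h1.2⟩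

/-- Termwise comparison of options implies comparison of games. -/
theorem le_of_options {m n m' n' : ℕ} {L : Fin m → ShortGame} {R : Fin n → ShortGame}
    {L' : Fin m' → ShortGame} {R' : Fin n' → ShortGame}
    (hL : ∀ i, ∃ i', Le (L i) (L' i')) (hR : ∀ j', ∃ j, Le (R j) (R' j')) :
    Le (mk L R) (mk L' R') := by
  refine le_mk_iff.2 ⟨fun i h => ?_, fun j' h => ?_⟩
  · obtain ⟨i', hi'⟩ := hL i
    exact not_le_left L' R' i' (le_trans _ _ _ h hi')
  · obtain ⟨j, hj⟩ := hR j'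
    exact not_right_le L R j (le_trans _ _ _ hj h)

/-- A form of least size among the forms of its value is canonical. -/
theorem isCanonical_of_minimal (G : ShortGame)
    (hG : ∀ H, Equal H G → G.size ≤ H.size) : IsCanonical G := by
  induction G with
  | mk L R ihL ihR =>
    rename_i m n
    have key : ∀ {m' n' : ℕ} (L' : Fin m' → ShortGame) (R' : Fin n' → ShortGame),
        Equal (mk L' R') (mk L R) →
        ∑ i, (L i).size + ∑ j, (R j).size ≤ ∑ i, (L' i).size + ∑ j, (R' j).size := by
      intro m' n' L' R' h
      have := hG _ h
      simp only [size] at this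
      omega
    have pos : ∀ K : ShortGame, 0 < K.size := by
      rintro ⟨A, B⟩
      simp only [size]
      omega
    refine ⟨fun i => ihL i fun H hH => ?_, fun j => ihR j fun H hH => ?_, fun i i' hne hle => ?_,
      fun j j' hne hle => ?_, fun i H hH hle => ?_, fun j H hH hle => ?_⟩
    · have hall : ∀ k, Equal (Function.update L i H k) (L k) := by
        intro k
        by_cases hk : k = i
        · subst hk
          simpa using hH
        · simpa [hk] using Equal.refl (L k)
      have := key (Function.update L i H) R
        ⟨le_of_options (fun k => ⟨k, (hall k).1⟩) (fun k => ⟨k, le_refl _⟩),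
          le_of_options (fun k => ⟨k, (hall k).2⟩) (fun k => ⟨k, le_refl _⟩)⟩
      have e1 := Finset.add_sum_erase Finset.univ (fun k => (L k).size) (Finset.mem_univ i)
      have e2 := Finset.add_sum_erase Finset.univ (fun k => (Function.update L i H k).size)
        (Finset.mem_univ i)
      have e3 : ∑ k ∈ Finset.univ.erase i, (Function.update L i H k).size =
          ∑ k ∈ Finset.univ.erase i, (L k).size :=
        Finset.sum_congr rfl fun k hk => by simp [Finset.ne_of_mem_erase hk]
      simp only [Function.update_self] at e1 e2
      omega
    · have hall : ∀ k, Equal (Function.update R j H k) (R k) := by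
        intro k
        by_cases hk : k = j
        · subst hk
          simpa using hH
        · simpa [hk] using Equal.refl (R k)
      have := key L (Function.update R j H)
        ⟨le_of_options (fun k => ⟨k, le_refl _⟩) (fun k => ⟨k, (hall k).1⟩),
          le_of_options (fun k => ⟨k, le_refl _⟩) (fun k => ⟨k, (hall k).2⟩)⟩
      have e1 := Finset.add_sum_erase Finset.univ (fun k => (R k).size) (Finset.mem_univ j)
      have e2 := Finset.add_sum_erase Finset.univ (fun k => (Function.update R j H k).size)
        (Finset.mem_univ j)
      have e3 : ∑ k ∈ Finset.univ.erase j, (Function.update R j H k).size =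
          ∑ k ∈ Finset.univ.erase j, (R k).size :=
        Finset.sum_congr rfl fun k hk => by simp [Finset.ne_of_mem_erase hk]
      simp only [Function.update_self] at e1 e2
      omega
    · cases m with
      | zero => exact i.elim0
      | succ m =>
        have := key (fun k => L (i.succAbove k)) R
          ⟨le_of_options (fun k => ⟨_, le_refl _⟩) (fun k => ⟨k, le_refl _⟩),
            le_of_options (fun k => ?_) (fun k => ⟨k, le_refl _⟩)⟩
        · have e := Fin.sum_univ_succAbove (fun k => (L k).size) i
          have := pos (L i)
          omega
        · by_cases hk : k = i
          · obtain ⟨z, hz⟩ := Fin.exists_succAbove_eq hne.symm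
            exact ⟨z, by rw [hz, hk]; exact hle⟩
          · obtain ⟨z, hz⟩ := Fin.exists_succAbove_eq hk
            exact ⟨z, by rw [hz]; exact le_refl _⟩
    · cases n with
      | zero => exact j.elim0
      | succ n =>
        have := key L (fun k => R (j.succAbove k))
          ⟨le_of_options (fun k => ⟨k, le_refl _⟩) (fun k => ?_),
            le_of_options (fun k => ⟨k, le_refl _⟩) (fun k => ⟨_, le_refl _⟩)⟩
        · have e := Fin.sum_univ_succAbove (fun k => (R k).size) j
          have := pos (R j)
          omega
        · by_cases hk : k = j
          · obtain ⟨z, hz⟩ := Fin.exists_succAbove_eq hne.symm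
            exact ⟨z, by rw [hz, hk]; exact hle⟩
          · obtain ⟨z, hz⟩ := Fin.exists_succAbove_eq hk
            exact ⟨z, by rw [hz]; exact le_refl _⟩
    · cases m with
      | zero => exact i.elim0
      | succ m =>
        have hs : H.size < (L i).size := by
          cases hLi : L i with
          | mk A B =>
            rw [hLi] at hH
            obtain ⟨j, rfl⟩ := hH
            exact size_right_lt A B j
        cases H with
        | mk C D =>
          set G' := mk (Fin.append (fun k => L (i.succAbove k)) C) R with hG'
          have optL : ∀ k, k ≠ i → ¬ Le G' (L k) := by
            intro k hk h
            obtain ⟨z, hz⟩ := Fin.exists_succAbove_eq hk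
            have := not_le_left (Fin.append (fun k => L (i.succAbove k)) C) R (Fin.castAdd _ z)
            rw [Fin.append_left, hz] at this
            exact this h
          have optC : ∀ k, ¬ Le G' (C k) := by
            intro k h
            have := not_le_left (Fin.append (fun k => L (i.succAbove k)) C) R (Fin.natAdd _ k)
            rw [Fin.append_right] at this
            exact this h
          have hHG' : Le (mk C D) G' :=
            le_mk_iff.2 ⟨optC, fun j h => not_right_le L R j (le_trans _ _ _ h hle)⟩
          have h1 : Le G' (mk L R) := by
            refine le_mk_iff.2 ⟨fun k h => ?_, fun j => not_right_le _ R j⟩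
            induction k using Fin.addCases with
            | left k =>
              rw [Fin.append_left] at h
              exact not_le_left L R _ h
            | right k =>
              rw [Fin.append_right] at h
              exact not_le_left C D k (le_trans _ _ _ hle h)
          have h2 : Le (mk L R) G' := by
            refine le_mk_iff.2 ⟨fun k h => ?_, fun j => not_right_le L R j⟩
            by_cases hk : k = i
            · subst hk
              cases hLi : L k with
              | mk A B =>
                rw [hLi] at h hH
                obtain ⟨j, hj⟩ := hH
                exact (le_mk_iff.1 h).2 j (hj ▸ hHG')
            · exact optL k hk h
          have := key _ _ ⟨h1, h2⟩
          have e := Fin.sum_univ_succAbove (fun k => (L k).size) i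
          rw [Fin.sum_univ_add (fun k => (Fin.append (fun k => L (i.succAbove k)) C k).size)] at this
          simp only [Fin.append_left, Fin.append_right] at this
          simp only [size] at hs
          omega
    · cases n with
      | zero => exact j.elim0
      | succ n =>
        have hs : H.size < (R j).size := by
          cases hRj : R j with
          | mk A B =>
            rw [hRj] at hH
            obtain ⟨i, rfl⟩ := hH
            exact size_left_lt A B i
        cases H with
        | mk C D =>
          set G' := mk L (Fin.append (fun k => R (j.succAbove k)) D) with hG'
          have optR : ∀ k, k ≠ j → ¬ Le (R k) G' := by
            intro k hk h
            obtain ⟨z, hz⟩ := Fin.exists_succAbove_eq hk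
            have := not_right_le L (Fin.append (fun k => R (j.succAbove k)) D) (Fin.castAdd _ z)
            rw [Fin.append_left, hz] at this
            exact this h
          have optD : ∀ k, ¬ Le (D k) G' := by
            intro k h
            have := not_right_le L (Fin.append (fun k => R (j.succAbove k)) D) (Fin.natAdd _ k)
            rw [Fin.append_right] at this
            exact this h
          have hHG' : Le G' (mk C D) :=
            le_mk_iff.2 ⟨fun i h => not_le_left L R i (le_trans _ _ _ hle h), optD⟩
          have h1 : Le (mk L R) G' := by
            refine le_mk_iff.2 ⟨fun i => not_le_left L _ i, fun k h => ?_⟩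
            induction k using Fin.addCases with
            | left k =>
              rw [Fin.append_left] at h
              exact not_right_le L R _ h
            | right k =>
              rw [Fin.append_right] at h
              exact not_right_le C D k (le_trans _ _ _ h hle)
          have h2 : Le G' (mk L R) := by
            refine le_mk_iff.2 ⟨fun i => not_le_left L R i, fun k h => ?_⟩
            by_cases hk : k = j
            · subst hk
              cases hRk : R k with
              | mk A B =>
                rw [hRk] at h hH
                obtain ⟨i, hi⟩ := hH
                exact (le_mk_iff.1 h).1 i (hi ▸ hHG')
            · exact optR k hk h
          have := key _ _ ⟨h2, h1⟩
          have e := Fin.sum_univ_succAbove (fun k => (R k).size) j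
          rw [Fin.sum_univ_add (fun k => (Fin.append (fun k => R (j.succAbove k)) D k).size)] at this
          simp only [Fin.append_left, Fin.append_right] at this
          simp only [size] at hs
          omega

theorem exists_canonical (G : ShortGame) : ∃ K, IsCanonical K ∧ Equal K G := by
  classical
  have hex : ∃ s, ∃ K : ShortGame, Equal K G ∧ K.size = s := ⟨_, G, Equal.refl G, rfl⟩
  obtain ⟨K, hK, hs⟩ := Nat.find_spec hex
  refine ⟨K, isCanonical_of_minimal K fun H hH => ?_, hK⟩
  rw [hs]
  exact Nat.find_min' hex ⟨H, hH.trans hK, rfl⟩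

/-- The canonical form of a short game (unique up to reordering of options). -/
noncomputable def canonicalForm (G : ShortGame) : ShortGame := (exists_canonical G).choose

theorem canonicalForm_spec (G : ShortGame) :
    IsCanonical (canonicalForm G) ∧ Equal (canonicalForm G) G := (exists_canonical G).choose_spec

/-! ### Disjunctive sum, dyadics, stops -/

/-- The sum `{L | R} + H`, by recursion on `H`, where `fL i` and `fR j` are the functions
`X ↦ L i + X` and `X ↦ R j + X`. -/
def addAux {m n : ℕ} (fL : Fin m → ShortGame → ShortGame) (fR : Fin n → ShortGame → ShortGame) :
    ShortGame → ShortGame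
  | mk L' R' =>
    mk (Fin.append (fun i => fL i (mk L' R')) (fun i => addAux fL fR (L' i)))
      (Fin.append (fun j => fR j (mk L' R')) (fun j => addAux fL fR (R' j)))

/-- The disjunctive sum `G + H = {G^L + H, G + H^L | G^R + H, G + H^R}`. -/
def add : ShortGame → ShortGame → ShortGame
  | mk L R => addAux (fun i => add (L i)) (fun j => add (R j))

/-- The game with no options. -/
def zero : ShortGame := mk ![] ![]

/-- The integer game `k = {k - 1 | }`. -/
def natGame : ℕ → ShortGame
  | 0 => zero
  | k + 1 => mk ![natGame k] ![]

/-- The integer game `-k = { | -k + 1}`. -/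
def negNatGame : ℕ → ShortGame
  | 0 => zero
  | k + 1 => mk ![] ![negNatGame k]

/-- The integer games. -/
def intGame : ℤ → ShortGame
  | Int.ofNat k => natGame k
  | Int.negSucc k => negNatGame (k + 1)

/-- The game `k / 2 ^ n`: the fraction is reduced if `k` is even, and it is
`{(k - 1) / 2 ^ n | (k + 1) / 2 ^ n}` (with reduced fractions) if `k` is odd and `n > 0`. -/
def dyadicGame : ℤ → ℕ → ShortGame
  | k, 0 => intGame k
  | k, n + 1 =>
    if Even k then dyadicGame (k / 2) n
    else mk ![dyadicGame ((k - 1) / 2) n] ![dyadicGame ((k + 1) / 2) n]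

/-- The dyadic rationals. -/
def IsDyadic (x : ℚ) : Prop := ∃ (k : ℤ) (n : ℕ), x = k / 2 ^ n

/-- The game of a dyadic rational (whose reduced denominator is a power of `2`). -/
def ratGame (x : ℚ) : ShortGame := dyadicGame x.num (Nat.log 2 x.den)

/-- `G` equals the dyadic `x`. -/
def EqualsDyadic (G : ShortGame) (x : ℚ) : Prop := IsDyadic x ∧ Equal G (ratGame x)

/-- The maximum of a nonempty finite family (and `0` for the empty family, a case that never
matters: a game where some player has no option equals an integer). -/
def finMax {m : ℕ} (f : Fin m → ℚ) : ℚ :=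
  if h : (Finset.univ : Finset (Fin m)).Nonempty then Finset.univ.sup' h f else 0

/-- The minimum of a nonempty finite family (and `0` for the empty family). -/
def finMin {m : ℕ} (f : Fin m → ℚ) : ℚ :=
  if h : (Finset.univ : Finset (Fin m)).Nonempty then Finset.univ.inf' h f else 0

open Classical in
/-- The pair (Left stop, Right stop): both are `x` if `G` equals the dyadic `x`; otherwise they are
the maximum of the Right stops of the Left options and the minimum of the Left stops of the Right
options. -/
noncomputable def stops : ShortGame → ℚ × ℚ
  | mk L R =>
    if h : ∃ x, EqualsDyadic (mk L R) x then (h.choose, h.choose)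
    else (finMax fun i => (stops (L i)).2, finMin fun j => (stops (R j)).1)

noncomputable def leftStop (G : ShortGame) : ℚ := (stops G).1

noncomputable def rightStop (G : ShortGame) : ℚ := (stops G).2

/-! ### Penalized positions and thermographs -/

/-- `t` is the least dyadic `q ≥ 0` such that the Left and Right stops of `F q` agree. -/
def IsFreezingPoint (F : ℚ → ShortGame) (t : ℚ) : Prop :=
  IsLeast {q : ℚ | IsDyadic q ∧ 0 ≤ q ∧ leftStop (F q) = rightStop (F q)} t

open Classical in
/-- `F p` for `p` up to the freezing point `t` of `F`, and the number which is the common value of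
the stops of `F t` for all `p > t`. -/
noncomputable def freeze (F : ℚ → ShortGame) (p : ℚ) : ShortGame :=
  if h : ∃ t, IsFreezingPoint F t ∧ t < p then ratGame (leftStop (F h.choose)) else F p

/-- `G` penalized by `p` (for a game `G` in canonical form and a dyadic `p ≥ 0`). -/
noncomputable def penalize : ShortGame → ℚ → ShortGame
  | mk L R =>
    freeze fun p =>
      mk (fun i => add (penalize (L i) p) (ratGame (-p)))
        (fun j => add (penalize (R j) p) (ratGame p))

/-- The large left wall: all points `(leftStop (G_p), p)`, with `p ≥ 0` dyadic. -/
noncomputable def leftWall (G : ShortGame) : Set (ℚ × ℚ) :=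
  {z | ∃ p, IsDyadic p ∧ 0 ≤ p ∧ z = (leftStop (penalize (canonicalForm G) p), p)}

/-- The large right wall: all points `(rightStop (G_p), p)`, with `p ≥ 0` dyadic. -/
noncomputable def rightWall (G : ShortGame) : Set (ℚ × ℚ) :=
  {z | ∃ p, IsDyadic p ∧ 0 ≤ p ∧ z = (rightStop (penalize (canonicalForm G) p), p)}

/-- The thermograph, as the plot of the two walls. -/
noncomputable def thermograph (G : ShortGame) : Set (ℚ × ℚ) × Set (ℚ × ℚ) :=
  (leftWall G, rightWall G)

/-! ### The rulesets -/

/-- Robin Hood `(n; a, b)`: Left may remove `1 ≤ i ≤ min n a` from the heap, which reduces Right's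
wealth by `i` (to `0`, if `i ≥ b`); symmetrically for Right.  Here `i`, `j` are shifted by one. -/
def robinHood (n a b : ℕ) : ShortGame :=
  mk (fun i : Fin (min n a) => robinHood (n - (i + 1)) a (b - (i + 1)))
    (fun j : Fin (min n b) => robinHood (n - (j + 1)) (a - (j + 1)) b)
termination_by n
decreasing_by
  · have := i.isLt
    omega
  · have := j.isLt
    omega

/-- Little John `(n; a, b)*`. -/
def littleJohn (n a b : ℕ) : ShortGame :=
  if n = 0 ∨ (a = 0 ∧ b = 0) then zero
  else if b = 0 then mk ![littleJohn (n - 1) a 0] ![]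
  else if a = 0 then mk ![] ![littleJohn (n - 1) 0 b]
  else
    mk ![littleJohn (n - min n (min a b)) a (b - min n (min a b))]
      ![littleJohn (n - min n (min a b)) (a - min n (min a b)) b]
termination_by n
decreasing_by
  all_goals omega

end ShortGame

namespace ShortGame

/-! ### Options -/

/-! On a large heap only two things matter: who ends up owning the heap, and how many tokens are
spent before the opponent's wealth is exhausted. Let φ be the golden ratio and let `a`, `b` not both
be zero. If a > φb (`Dominates a b`), Left wins the heap whoever starts; if b > φa, Right does;
otherwise the player who starts does. Equality is impossible because φ is irrational. The winner
wants to waste few tokens and the loser wants to waste many, and both aims are served by removing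
min{a, b} tokens, which is the only Little John move on a large heap. `killCost` counts the waste
under this greedy play; `killCost_le_of_dominates` and `Dominates.add_killCost_le` say that no other
Robin Hood move improves on it.

This gives the walls explicitly (`bigRight`; the Left wall follows by symmetry). In the contested
case, with A = `killCost a b` and B = `killCost b a`, the scaffolds n − A − p and −n + B + p meet at
p = n − (A + B)/2 above the value (B − A)/2. If Left dominates and C = `killCost (a - b) b`, the
Left scaffold n − b − p meets the constant Right scaffold n − b − C at p = C. `IsHeap.hasBigWalls`
derives these formulas from the walls of the options, using only that each option is some permitted
removal and that the greedy one is among them. So one induction on a + b (`exists_hasBigWalls`)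
serves both rulesets.

Two general facts make the computation legitimate. Walls are monotone in the game (`walls_mono`), so
they depend only on the value and may be read off any form instead of the canonical one. Scaffolds
are piecewise linear with dyadic breakpoints (`Cool`), so the least dyadic penalty at which they
meet exists (`Cool.exists_crossing`). -/

theorem le_iff {G H : ShortGame} : Le G H ↔
    (∀ K, G.IsLeftOption K → ¬ Le H K) ∧ (∀ K, H.IsRightOption K → ¬ Le K G) := by
  cases G; cases H
  rw [le_mk_iff]
  simp [IsLeftOption, IsRightOption]

theorem IsLeftOption.not_le {G K : ShortGame} (h : G.IsLeftOption K) : ¬ Le G K :=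
  (le_iff.1 (le_refl G)).1 K h

theorem IsRightOption.not_le {G K : ShortGame} (h : G.IsRightOption K) : ¬ Le K G :=
  (le_iff.1 (le_refl G)).2 K h

theorem IsLeftOption.size_lt {G K : ShortGame} (h : G.IsLeftOption K) : K.size < G.size := by
  cases G
  obtain ⟨i, rfl⟩ := h
  exact size_left_lt _ _ i

theorem IsRightOption.size_lt {G K : ShortGame} (h : G.IsRightOption K) : K.size < G.size := by
  cases G
  obtain ⟨i, rfl⟩ := h
  exact size_right_lt _ _ i

theorem not_le_iff {G H : ShortGame} : ¬ Le G H ↔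
    (∃ K, G.IsLeftOption K ∧ Le H K) ∨ (∃ K, H.IsRightOption K ∧ Le K G) := by
  rw [le_iff, not_and_or]
  simp

/-! ### Disjunctive sums: options and order. -/

theorem add_mk_mk {m n m' n' : ℕ} (L : Fin m → ShortGame) (R : Fin n → ShortGame)
    (L' : Fin m' → ShortGame) (R' : Fin n' → ShortGame) :
    add (mk L R) (mk L' R') =
      mk (Fin.append (fun i => add (L i) (mk L' R')) (fun i => add (mk L R) (L' i)))
        (Fin.append (fun j => add (R j) (mk L' R')) (fun j => add (mk L R) (R' j))) := by
  simp only [add, addAux]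

theorem isLeftOption_add {G H K : ShortGame} : (add G H).IsLeftOption K ↔
    (∃ G', G.IsLeftOption G' ∧ K = add G' H) ∨ (∃ H', H.IsLeftOption H' ∧ K = add G H') := by
  cases G with | mk L R =>
  cases H with | mk L' R' =>
  rw [add_mk_mk]
  constructor
  · rintro ⟨i, rfl⟩
    induction i using Fin.addCases with
    | left k => exact Or.inl ⟨L k, ⟨k, rfl⟩, by rw [Fin.append_left]⟩
    | right k => exact Or.inr ⟨L' k, ⟨k, rfl⟩, by rw [Fin.append_right]⟩
  · rintro (⟨_, ⟨k, rfl⟩, rfl⟩ | ⟨_, ⟨k, rfl⟩, rfl⟩)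
    · exact ⟨Fin.castAdd _ k, by rw [Fin.append_left]⟩
    · exact ⟨Fin.natAdd _ k, by rw [Fin.append_right]⟩

theorem isRightOption_add {G H K : ShortGame} : (add G H).IsRightOption K ↔
    (∃ G', G.IsRightOption G' ∧ K = add G' H) ∨ (∃ H', H.IsRightOption H' ∧ K = add G H') := by
  cases G with | mk L R =>
  cases H with | mk L' R' =>
  rw [add_mk_mk]
  constructor
  · rintro ⟨i, rfl⟩
    induction i using Fin.addCases with
    | left k => exact Or.inl ⟨R k, ⟨k, rfl⟩, by rw [Fin.append_left]⟩
    | right k => exact Or.inr ⟨R' k, ⟨k, rfl⟩, by rw [Fin.append_right]⟩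
  · rintro (⟨_, ⟨k, rfl⟩, rfl⟩ | ⟨_, ⟨k, rfl⟩, rfl⟩)
    · exact ⟨Fin.castAdd _ k, by rw [Fin.append_left]⟩
    · exact ⟨Fin.natAdd _ k, by rw [Fin.append_right]⟩

theorem not_isLeftOption_zero (K : ShortGame) : ¬ zero.IsLeftOption K := by
  rintro ⟨i, -⟩
  exact i.elim0

theorem not_isRightOption_zero (K : ShortGame) : ¬ zero.IsRightOption K := by
  rintro ⟨i, -⟩
  exact i.elim0

/-- Addition of a game on the right preserves and reflects the order. -/
theorem add_le_add_right_iff (G H K : ShortGame) : Le (add G K) (add H K) ↔ Le G H := by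
  induction hN : G.size + H.size + K.size using Nat.strong_induction_on generalizing G H K with
  | _ N ih =>
  subst hN
  constructor
  · intro h
    refine le_iff.2 ⟨fun G' hG' h' => ?_, fun H' hH' h' => ?_⟩
    · have := hG'.size_lt
      exact (le_iff.1 h).1 _ (isLeftOption_add.2 (Or.inl ⟨G', hG', rfl⟩))
        ((ih _ (by omega) H G' K rfl).2 h')
    · have := hH'.size_lt
      exact (le_iff.1 h).2 _ (isRightOption_add.2 (Or.inl ⟨H', hH', rfl⟩))
        ((ih _ (by omega) H' G K rfl).2 h')
  · intro h
    refine le_iff.2 ⟨fun X hX h' => ?_, fun X hX h' => ?_⟩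
    · obtain ⟨G', hG', rfl⟩ | ⟨K', hK', rfl⟩ := isLeftOption_add.1 hX
      · have := hG'.size_lt
        exact (le_iff.1 h).1 _ hG' ((ih _ (by omega) H G' K rfl).1 h')
      · have := hK'.size_lt
        exact (isLeftOption_add.2 (Or.inr ⟨K', hK', rfl⟩)).not_le
          (le_trans _ _ _ h' ((ih _ (by omega) G H K' rfl).2 h))
    · obtain ⟨H', hH', rfl⟩ | ⟨K', hK', rfl⟩ := isRightOption_add.1 hX
      · have := hH'.size_lt
        exact (le_iff.1 h).2 _ hH' ((ih _ (by omega) H' G K rfl).1 h')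
      · have := hK'.size_lt
        exact (isRightOption_add.2 (Or.inr ⟨K', hK', rfl⟩)).not_le
          (le_trans _ _ _ ((ih _ (by omega) G H K' rfl).2 h) h')

theorem Equal.symm {G H : ShortGame} (h : Equal G H) : Equal H G := ⟨h.2, h.1⟩

theorem add_zero_equal (G : ShortGame) : Equal (add G zero) G := by
  induction hN : G.size using Nat.strong_induction_on generalizing G with
  | _ N ih =>
  subst hN
  constructor
  · refine le_iff.2 ⟨fun X hX h => ?_, fun K hK h => ?_⟩
    · obtain ⟨G', hG', rfl⟩ | ⟨K', hK', rfl⟩ := isLeftOption_add.1 hX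
      · exact hG'.not_le (le_trans _ _ _ h (ih _ hG'.size_lt G' rfl).1)
      · exact not_isLeftOption_zero _ hK'
    · exact (isRightOption_add.2 (Or.inl ⟨K, hK, rfl⟩)).not_le
        (le_trans _ _ _ (ih _ hK.size_lt K rfl).1 h)
  · refine le_iff.2 ⟨fun K hK h => ?_, fun X hX h => ?_⟩
    · exact (isLeftOption_add.2 (Or.inl ⟨K, hK, rfl⟩)).not_le
        (le_trans _ _ _ h (ih _ hK.size_lt K rfl).2)
    · obtain ⟨G', hG', rfl⟩ | ⟨K', hK', rfl⟩ := isRightOption_add.1 hX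
      · exact hG'.not_le (le_trans _ _ _ (ih _ hG'.size_lt G' rfl).2 h)
      · exact not_isRightOption_zero _ hK'

/-! ### Dyadic rationals -/

theorem isDyadic_natCast (k : ℕ) : IsDyadic (k : ℚ) := ⟨k, 0, by simp⟩

theorem isDyadic_zero : IsDyadic 0 := ⟨0, 0, by simp⟩

theorem IsDyadic.neg {x : ℚ} (hx : IsDyadic x) : IsDyadic (-x) := by
  obtain ⟨k, n, rfl⟩ := hx
  exact ⟨-k, n, by push_cast; ring⟩

theorem IsDyadic.add {x y : ℚ} (hx : IsDyadic x) (hy : IsDyadic y) : IsDyadic (x + y) := by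
  obtain ⟨k, n, rfl⟩ := hx
  obtain ⟨l, m, rfl⟩ := hy
  refine ⟨k * 2 ^ m + l * 2 ^ n, n + m, ?_⟩
  push_cast
  rw [pow_add]
  field_simp

theorem IsDyadic.sub {x y : ℚ} (hx : IsDyadic x) (hy : IsDyadic y) : IsDyadic (x - y) := by
  rw [sub_eq_add_neg]
  exact hx.add hy.neg

theorem IsDyadic.div_two {x : ℚ} (hx : IsDyadic x) : IsDyadic (x / 2) := by
  obtain ⟨k, n, rfl⟩ := hx
  exact ⟨k, n + 1, by rw [pow_succ]; field_simp⟩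

theorem IsDyadic.min {x y : ℚ} (hx : IsDyadic x) (hy : IsDyadic y) : IsDyadic (min x y) := by
  rcases min_choice x y with h | h <;> rw [h] <;> assumption

theorem exists_isDyadic_between {x y : ℚ} (hx : IsDyadic x) (hy : IsDyadic y) (h : x < y) :
    ∃ z, IsDyadic z ∧ x < z ∧ z < y :=
  ⟨(x + y) / 2, (hx.add hy).div_two, by linarith, by linarith⟩

theorem IsDyadic.exists_den {x : ℚ} (hx : IsDyadic x) : ∃ n : ℕ, x.den = 2 ^ n := by
  obtain ⟨k, n, rfl⟩ := hx
  have h : ((k : ℚ) / 2 ^ n).den ∣ 2 ^ n := by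
    have := Rat.den_dvd k (2 ^ n)
    have h2 : ((k : ℚ) / 2 ^ n) = ((k : ℤ) : ℚ) / ((2 ^ n : ℤ) : ℚ) := by push_cast; rfl
    rw [Rat.divInt_eq_div] at this
    rw [h2]
    exact_mod_cast this
  obtain ⟨m, -, hm⟩ := (Nat.dvd_prime_pow Nat.prime_two).1 h
  exact ⟨m, hm⟩

theorem IsDyadic.inv_den {x : ℚ} (hx : IsDyadic x) : IsDyadic (1 / x.den) := by
  obtain ⟨n, hn⟩ := hx.exists_den
  exact ⟨1, n, by rw [hn]; push_cast; rfl⟩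

theorem den_odd_div {k : ℤ} (hk : ¬ Even k) (n : ℕ) :
    ((k : ℚ) / 2 ^ n).num = k ∧ ((k : ℚ) / 2 ^ n).den = 2 ^ n := by
  have hc : Nat.Coprime k.natAbs (2 ^ n) := by
    apply Nat.Coprime.pow_right
    rw [Nat.coprime_two_right]
    exact Int.natAbs_odd.2 (Int.not_even_iff_odd.1 hk)
  have h0 : (2 ^ n : ℕ) ≠ 0 := by positivity
  have : ((k : ℚ) / 2 ^ n) = Rat.mk' k (2 ^ n) h0 hc := by
    rw [Rat.mk_eq_divInt, Rat.divInt_eq_div]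
    push_cast
    rfl
  rw [this]
  exact ⟨rfl, rfl⟩

theorem dyadicGame_eq (n : ℕ) : ∀ k : ℤ, dyadicGame k n = ratGame ((k : ℚ) / 2 ^ n) := by
  induction n with
  | zero =>
    intro k
    simp [ratGame]
  | succ n ih =>
    intro k
    by_cases hk : Even k
    · rw [dyadicGame, if_pos hk, ih]
      congr 1
      obtain ⟨l, rfl⟩ := hk
      have : (l + l) / 2 = l := by omega
      rw [this, pow_succ]
      push_cast
      field_simp
      ring
    · obtain ⟨h1, h2⟩ := den_odd_div hk (n + 1)
      rw [ratGame, h1, h2, Nat.log_pow (by norm_num)]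

theorem IsDyadic.ratGame_eq {x : ℚ} (hx : IsDyadic x) :
    (1 < x.den → ratGame x = mk ![ratGame (x - 1 / x.den)] ![ratGame (x + 1 / x.den)]) := by
  intro hd
  obtain ⟨n, hn⟩ := hx.exists_den
  cases n with
  | zero => simp [hn] at hd
  | succ n =>
    have hodd : ¬ Even x.num := by
      intro he
      have h1 := x.reduced
      rw [hn] at h1
      have h2 : 2 ∣ x.num.natAbs := (Int.natAbs_even.2 he).two_dvd
      have h3 := Nat.dvd_gcd h2 (Dvd.intro_left (2 ^ n) (pow_succ 2 n).symm)
      rw [h1] at h3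
      omega
    have hx' : x = x.num / 2 ^ (n + 1) := by
      conv_lhs => rw [← Rat.num_div_den x, hn]
      push_cast
      rfl
    have e1 : (((x.num - 1) / 2 : ℤ) : ℚ) / 2 ^ n = x - 1 / x.den := by
      obtain ⟨l, hl⟩ := Int.not_even_iff_odd.1 hodd
      have : (x.num - 1) / 2 = l := by omega
      rw [this, hn]
      conv_rhs => rw [hx', hl]
      push_cast
      rw [pow_succ]
      field_simp
      ring
    have e2 : (((x.num + 1) / 2 : ℤ) : ℚ) / 2 ^ n = x + 1 / x.den := by
      obtain ⟨l, hl⟩ := Int.not_even_iff_odd.1 hodd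
      have : (x.num + 1) / 2 = l + 1 := by omega
      rw [this, hn]
      conv_rhs => rw [hx', hl]
      push_cast
      rw [pow_succ]
      field_simp
      ring
    rw [← e1, ← e2, ← dyadicGame_eq, ← dyadicGame_eq, ratGame, hn, Nat.log_pow (by norm_num),
      dyadicGame, if_neg hodd]

theorem ratGame_intCast (k : ℤ) : ratGame (k : ℚ) = intGame k := by
  simp [ratGame, dyadicGame]

theorem ratGame_natCast (k : ℕ) : ratGame (k : ℚ) = natGame k := by
  have := ratGame_intCast k
  simpa [intGame] using this

theorem ratGame_neg_natCast (k : ℕ) : ratGame (-(k : ℚ)) = negNatGame k := by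
  have := ratGame_intCast (-k)
  push_cast at this
  rw [this]
  cases k with
  | zero => rfl
  | succ k => rfl

theorem ratGame_zero : ratGame 0 = zero := by
  have := ratGame_natCast 0
  simpa [natGame] using this

theorem eq_natCast_or_of_den_eq_one {x : ℚ} (h : x.den = 1) :
    x = 0 ∨ (∃ k : ℕ, x = (k + 1 : ℕ)) ∨ ∃ k : ℕ, x = -(k + 1 : ℕ) := by
  have hx : x = (x.num : ℚ) := by
    conv_lhs => rw [← Rat.num_div_den x, h]
    simp
  rw [hx]
  rcases lt_trichotomy x.num 0 with h | h | h
  · refine Or.inr (Or.inr ⟨(-x.num - 1).toNat, ?_⟩)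
    have : x.num = -(((-x.num - 1).toNat + 1 : ℕ) : ℤ) := by omega
    rw [this]
    push_cast
    simp
  · left
    simp [h]
  · refine Or.inr (Or.inl ⟨(x.num - 1).toNat, ?_⟩)
    have : x.num = (((x.num - 1).toNat + 1 : ℕ) : ℤ) := by omega
    rw [this]
    push_cast
    simp

/-- A positive integer has denominator 1, so its option `x - 1` also has the form `x - 1 / x.den`.
One formula thus serves integers and fractions, and only the condition for the option to exist tells
them apart. -/
theorem isLeftOption_ratGame {x : ℚ} (hx : IsDyadic x) {K : ShortGame} :
    (ratGame x).IsLeftOption K ↔ (1 < x.den ∨ 0 < x) ∧ K = ratGame (x - 1 / x.den) := by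
  by_cases hd : 1 < x.den
  · rw [hx.ratGame_eq hd]
    simp [IsLeftOption, hd, eq_comm]
  · have h1 : x.den = 1 := by have := x.den_pos; omega
    obtain h | ⟨k, hk⟩ | ⟨k, hk⟩ := eq_natCast_or_of_den_eq_one h1
    · subst h
      rw [ratGame_zero]
      simp [not_isLeftOption_zero]
    · have h2 : x - 1 / x.den = (k : ℕ) := by rw [h1, hk]; push_cast; ring
      have h3 : 0 < x := by rw [hk]; positivity
      rw [h2, ratGame_natCast k]
      rw [hk, ratGame_natCast, natGame]
      have h4 : (0 : ℚ) < k + 1 := by positivity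
      simp [IsLeftOption, h4, eq_comm]
    · have h3 : ¬ 0 < x := by rw [hk, not_lt, neg_nonpos]; positivity
      rw [hk, ratGame_neg_natCast, negNatGame]
      rw [hk] at hd h3
      simp only [hd, h3, or_self, false_and, iff_false]
      rintro ⟨i, -⟩
      exact i.elim0

theorem isRightOption_ratGame {x : ℚ} (hx : IsDyadic x) {K : ShortGame} :
    (ratGame x).IsRightOption K ↔ (1 < x.den ∨ x < 0) ∧ K = ratGame (x + 1 / x.den) := by
  by_cases hd : 1 < x.den
  · rw [hx.ratGame_eq hd]
    simp [IsRightOption, hd, eq_comm]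
  · have h1 : x.den = 1 := by have := x.den_pos; omega
    obtain h | ⟨k, hk⟩ | ⟨k, hk⟩ := eq_natCast_or_of_den_eq_one h1
    · subst h
      rw [ratGame_zero]
      simp [not_isRightOption_zero]
    · have h3 : ¬ x < 0 := by rw [hk, not_lt]; positivity
      rw [hk, ratGame_natCast, natGame]
      rw [hk] at hd h3
      simp only [hd, h3, or_self, false_and, iff_false]
      rintro ⟨i, -⟩
      exact i.elim0
    · have h2 : x + 1 / x.den = -(k : ℕ) := by rw [h1, hk]; push_cast; ring
      have h3 : x < 0 := by rw [hk, neg_lt_zero]; positivity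
      rw [h2, ratGame_neg_natCast k]
      rw [hk, ratGame_neg_natCast, negNatGame]
      simp only [IsRightOption]
      rw [hk] at h3
      simp only [h3, or_true, true_and]
      simp [eq_comm]

theorem inv_den_pos (x : ℚ) : 0 < 1 / (x.den : ℚ) := by
  have := x.den_pos
  positivity

theorem exists_intCast_div {x : ℚ} {n m : ℕ} (h : x.den = 2 ^ n) (hnm : n ≤ m) :
    ∃ k : ℤ, x = k / 2 ^ m := by
  refine ⟨x.num * 2 ^ (m - n), ?_⟩
  have hx : x = x.num / 2 ^ n := by
    conv_lhs => rw [← Rat.num_div_den x, h]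
    push_cast
    rfl
  obtain ⟨d, rfl⟩ := Nat.exists_eq_add_of_le hnm
  rw [Nat.add_sub_cancel_left]
  conv_lhs => rw [hx]
  rw [pow_add]
  push_cast
  field_simp

/-- The denominators of three dyadics bound from below how much they can differ. -/
theorem exists_option_of_lt_add {x y z : ℚ} (hx : IsDyadic x) (hy : IsDyadic y) (hz : IsDyadic z)
    (h : z < x + y) :
    ((1 < x.den ∨ 0 < x) ∧ z ≤ x - 1 / x.den + y) ∨
    ((1 < y.den ∨ 0 < y) ∧ z ≤ x + (y - 1 / y.den)) ∨
    ((1 < z.den ∨ z < 0) ∧ z + 1 / z.den ≤ x + y) := by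
  obtain ⟨a, ha⟩ := hx.exists_den
  obtain ⟨b, hb⟩ := hy.exists_den
  obtain ⟨c, hc⟩ := hz.exists_den
  -- All three numbers lie on the grid of mesh `1 / 2 ^ m`, so a positive difference is at least one
  -- mesh.
  have gap : ∀ m, a ≤ m → b ≤ m → c ≤ m → 1 / (2 ^ m : ℚ) ≤ x + y - z := by
    intro m h1 h2 h3
    obtain ⟨i, hi⟩ := exists_intCast_div ha h1
    obtain ⟨j, hj⟩ := exists_intCast_div hb h2
    obtain ⟨k, hk⟩ := exists_intCast_div hc h3
    rw [hi, hj, hk] at h ⊢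
    have e : (i : ℚ) / 2 ^ m + j / 2 ^ m - k / 2 ^ m = ((i + j - k : ℤ) : ℚ) / 2 ^ m := by
      push_cast
      ring
    have h' : (0 : ℚ) < ((i + j - k : ℤ) : ℚ) / 2 ^ m := by rw [← e]; linarith
    rw [e]
    have h4 : (0 : ℚ) < ((i + j - k : ℤ) : ℚ) := by
      by_contra h0
      exact absurd h' (not_lt.2 (div_nonpos_of_nonpos_of_nonneg (not_lt.1 h0) (by positivity)))
    have h5 : (1 : ℚ) ≤ ((i + j - k : ℤ) : ℚ) := by
      have : 0 < i + j - k := by exact_mod_cast h4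
      exact_mod_cast this
    gcongr
  have big : ∀ {m : ℕ}, m ≠ 0 → 1 < 2 ^ m := fun hm => Nat.one_lt_two_pow hm
  -- The number with the largest denominator can be moved by one unit of its own mesh without
  -- breaking the inequality. If all three are integers, an option must also exist, and `z < x + y`
  -- forces `0 < x`, `0 < y` or `z < 0`.
  by_cases h0 : a = 0 ∧ b = 0 ∧ c = 0
  · obtain ⟨rfl, rfl, rfl⟩ := h0
    have g := gap 0 le_rfl le_rfl le_rfl
    rw [ha, hb, hc]
    norm_num at g ⊢
    by_cases hx0 : 0 < x
    · left; exact ⟨hx0, by linarith⟩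
    by_cases hy0 : 0 < y
    · right; left; exact ⟨hy0, by linarith⟩
    · right; right; exact ⟨by linarith, by linarith⟩
  · by_cases hA : b ≤ a ∧ c ≤ a
    · left
      have g := gap a le_rfl hA.1 hA.2
      rw [ha]
      refine ⟨Or.inl (big (by omega)), ?_⟩
      push_cast
      linarith
    · by_cases hB : a ≤ b ∧ c ≤ b
      · right; left
        have g := gap b hB.1 le_rfl hB.2
        rw [hb]
        refine ⟨Or.inl (big (by omega)), ?_⟩
        push_cast
        linarith
      · right; right
        have g := gap c (by omega) (by omega) le_rfl
        rw [hc]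
        refine ⟨Or.inl (big (by omega)), ?_⟩
        push_cast
        linarith

/-- Comparison of a sum of two dyadics with a third one. -/
theorem add_ratGame_le_iff_and {x y z : ℚ} (hx : IsDyadic x) (hy : IsDyadic y) (hz : IsDyadic z) :
    (Le (add (ratGame x) (ratGame y)) (ratGame z) ↔ x + y ≤ z) ∧
    (Le (ratGame z) (add (ratGame x) (ratGame y)) ↔ z ≤ x + y) := by
  induction hN : (ratGame x).size + (ratGame y).size + (ratGame z).size using
    Nat.strong_induction_on generalizing x y z with
  | _ N ih =>
  subst hN
  have px := inv_den_pos x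
  have py := inv_den_pos y
  have pz := inv_den_pos z
  have dxl := hx.sub hx.inv_den
  have dyl := hy.sub hy.inv_den
  have dzl := hz.sub hz.inv_den
  have dxr := hx.add hx.inv_den
  have dyr := hy.add hy.inv_den
  have dzr := hz.add hz.inv_den
  refine ⟨⟨fun h => ?_, fun h => ?_⟩, ⟨fun h => ?_, fun h => ?_⟩⟩
  · by_contra hlt
    obtain ⟨h1, h2⟩ | ⟨h1, h2⟩ | ⟨h1, h2⟩ := exists_option_of_lt_add hx hy hz (not_le.1 hlt)
    · have o := (isLeftOption_ratGame hx).2 ⟨h1, rfl⟩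
      have := o.size_lt
      exact (le_iff.1 h).1 _ (isLeftOption_add.2 (Or.inl ⟨_, o, rfl⟩))
        ((ih _ (by omega) dxl hy hz rfl).2.2 h2)
    · have o := (isLeftOption_ratGame hy).2 ⟨h1, rfl⟩
      have := o.size_lt
      exact (le_iff.1 h).1 _ (isLeftOption_add.2 (Or.inr ⟨_, o, rfl⟩))
        ((ih _ (by omega) hx dyl hz rfl).2.2 h2)
    · have o := (isRightOption_ratGame hz).2 ⟨h1, rfl⟩
      have := o.size_lt
      exact (le_iff.1 h).2 _ o ((ih _ (by omega) hx hy dzr rfl).2.2 h2)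
  · refine le_iff.2 ⟨fun K hK h' => ?_, fun K hK h' => ?_⟩
    · obtain ⟨X, o, rfl⟩ | ⟨X, o, rfl⟩ := isLeftOption_add.1 hK
      · have := o.size_lt
        obtain ⟨-, rfl⟩ := (isLeftOption_ratGame hx).1 o
        have := (ih _ (by omega) dxl hy hz rfl).2.1 h'
        linarith
      · have := o.size_lt
        obtain ⟨-, rfl⟩ := (isLeftOption_ratGame hy).1 o
        have := (ih _ (by omega) hx dyl hz rfl).2.1 h'
        linarith
    · have := hK.size_lt
      obtain ⟨-, rfl⟩ := (isRightOption_ratGame hz).1 hK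
      have := (ih _ (by omega) hx hy dzr rfl).2.1 h'
      linarith
  · by_contra hlt
    -- Negation exchanges the players and keeps denominators, so the same lemma supplies the good
    -- move of the other side.
    have key := exists_option_of_lt_add hx.neg hy.neg hz.neg (by linarith)
    simp only [Rat.den_neg_eq_den] at key
    obtain ⟨h1, h2⟩ | ⟨h1, h2⟩ | ⟨h1, h2⟩ := key
    · have o := (isRightOption_ratGame hx).2 ⟨h1.imp id (by intro; linarith), rfl⟩
      have := o.size_lt
      exact (le_iff.1 h).2 _ (isRightOption_add.2 (Or.inl ⟨_, o, rfl⟩))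
        ((ih _ (by omega) dxr hy hz rfl).1.2 (by linarith))
    · have o := (isRightOption_ratGame hy).2 ⟨h1.imp id (by intro; linarith), rfl⟩
      have := o.size_lt
      exact (le_iff.1 h).2 _ (isRightOption_add.2 (Or.inr ⟨_, o, rfl⟩))
        ((ih _ (by omega) hx dyr hz rfl).1.2 (by linarith))
    · have o := (isLeftOption_ratGame hz).2 ⟨h1.imp id (by intro; linarith), rfl⟩
      have := o.size_lt
      exact (le_iff.1 h).1 _ o ((ih _ (by omega) hx hy dzl rfl).1.2 (by linarith))
  · refine le_iff.2 ⟨fun K hK h' => ?_, fun K hK h' => ?_⟩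
    · have := hK.size_lt
      obtain ⟨-, rfl⟩ := (isLeftOption_ratGame hz).1 hK
      have := (ih _ (by omega) hx hy dzl rfl).1.1 h'
      linarith
    · obtain ⟨X, o, rfl⟩ | ⟨X, o, rfl⟩ := isRightOption_add.1 hK
      · have := o.size_lt
        obtain ⟨-, rfl⟩ := (isRightOption_ratGame hx).1 o
        have := (ih _ (by omega) dxr hy hz rfl).1.1 h'
        linarith
      · have := o.size_lt
        obtain ⟨-, rfl⟩ := (isRightOption_ratGame hy).1 o
        have := (ih _ (by omega) hx dyr hz rfl).1.1 h'
        linarith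

theorem add_ratGame_equal {x y : ℚ} (hx : IsDyadic x) (hy : IsDyadic y) :
    Equal (add (ratGame x) (ratGame y)) (ratGame (x + y)) :=
  ⟨(add_ratGame_le_iff_and hx hy (hx.add hy)).1.2 le_rfl,
    (add_ratGame_le_iff_and hx hy (hx.add hy)).2.2 le_rfl⟩

theorem ratGame_le_iff {x y : ℚ} (hx : IsDyadic x) (hy : IsDyadic y) :
    Le (ratGame x) (ratGame y) ↔ x ≤ y := by
  have h := (add_ratGame_le_iff_and hx isDyadic_zero hy).1
  rw [ratGame_zero, add_zero] at h
  have e := add_zero_equal (ratGame x)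
  exact ⟨fun h' => h.1 (le_trans _ _ _ e.1 h'), fun h' => le_trans _ _ _ e.2 (h.2 h')⟩

/-! ### Games that equal numbers -/

/-- A game with a number strictly between its Left and its Right options equals a number. -/
theorem exists_equalsDyadic_of_fits {G : ShortGame} {y : ℚ} (hy : IsDyadic y)
    (hL : ∀ K, G.IsLeftOption K → ¬ Le (ratGame y) K)
    (hR : ∀ K, G.IsRightOption K → ¬ Le K (ratGame y)) : ∃ x, EqualsDyadic G x := by
  induction hN : (ratGame y).size using Nat.strong_induction_on generalizing y with
  | _ N ih =>
  subst hN
  -- Simplicity argument: if `y` fits but is not equal to `G`, the failing comparison exhibits an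
  -- option of `y` that also fits and is smaller.
  by_cases h1 : Le G (ratGame y)
  · by_cases h2 : Le (ratGame y) G
    · exact ⟨y, hy, h1, h2⟩
    · obtain ⟨K, hK, h3⟩ | ⟨K, hK, h3⟩ := not_le_iff.1 h2
      · have hs := hK.size_lt
        obtain ⟨-, rfl⟩ := (isLeftOption_ratGame hy).1 hK
        refine ih _ hs (hy.sub hy.inv_den) (fun X hX h => ?_) (fun X hX h => ?_) rfl
        · exact hX.not_le (le_trans _ _ _ h3 h)
        · refine hR X hX (le_trans _ _ _ h ((ratGame_le_iff (hy.sub hy.inv_den) hy).2 ?_))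
          have := inv_den_pos y
          linarith
      · exact absurd h3 (hR K hK)
  · obtain ⟨K, hK, h3⟩ | ⟨K, hK, h3⟩ := not_le_iff.1 h1
    · exact absurd h3 (hL K hK)
    · have hs := hK.size_lt
      obtain ⟨-, rfl⟩ := (isRightOption_ratGame hy).1 hK
      refine ih _ hs (hy.add hy.inv_den) (fun X hX h => ?_) (fun X hX h => ?_) rfl
      · refine hL X hX (le_trans _ _ _ ((ratGame_le_iff hy (hy.add hy.inv_den)).2 ?_) h)
        have := inv_den_pos y
        linarith
      · exact hX.not_le (le_trans _ _ _ h h3)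

theorem ratGame_neg_le_of_size_le {G : ShortGame} {n : ℕ} (h : G.size ≤ n) :
    Le (ratGame (-(n : ℚ))) G := by
  induction n generalizing G with
  | zero =>
    cases G
    simp [size] at h
  | succ n ih =>
    have d : ∀ k : ℕ, IsDyadic (-(k : ℚ)) := fun k => (isDyadic_natCast k).neg
    refine le_iff.2 ⟨fun K hK h' => ?_, fun K hK h' => ?_⟩
    · obtain ⟨h1, -⟩ := (isLeftOption_ratGame (d _)).1 hK
      rw [Rat.den_neg_eq_den, Rat.den_natCast] at h1
      have : (0 : ℚ) ≤ (n + 1 : ℕ) := by positivity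
      rcases h1 with h1 | h1
      · omega
      · linarith
    · have := hK.size_lt
      have := (ratGame_le_iff (d _) (d _)).1 (le_trans _ _ _ (ih (G := K) (by omega)) h')
      push_cast at this
      linarith

theorem le_ratGame_of_size_le {G : ShortGame} {n : ℕ} (h : G.size ≤ n) :
    Le G (ratGame (n : ℚ)) := by
  induction n generalizing G with
  | zero =>
    cases G
    simp [size] at h
  | succ n ih =>
    refine le_iff.2 ⟨fun K hK h' => ?_, fun K hK h' => ?_⟩
    · have := hK.size_lt
      have := (ratGame_le_iff (isDyadic_natCast _) (isDyadic_natCast _)).1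
        (le_trans _ _ _ h' (ih (G := K) (by omega)))
      push_cast at this
      linarith
    · obtain ⟨h1, -⟩ := (isRightOption_ratGame (isDyadic_natCast _)).1 hK
      rw [Rat.den_natCast] at h1
      have : (0 : ℚ) ≤ (n + 1 : ℕ) := by positivity
      rcases h1 with h1 | h1
      · omega
      · linarith

/-- If Left has no option, the integer `-G.size` lies below every Right option and therefore fits,
which makes `G` a number. Hence the default value of `finMax` on the empty family never enters
`stops`. -/
theorem exists_isLeftOption {G : ShortGame} (h : ¬ ∃ x, EqualsDyadic G x) :
    ∃ K, G.IsLeftOption K := by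
  by_contra hno
  push Not at hno
  refine h (exists_equalsDyadic_of_fits (isDyadic_natCast G.size).neg
    (fun K hK => absurd hK (hno K)) (fun K hK h' => ?_))
  have hs := hK.size_lt
  have h2 := ratGame_neg_le_of_size_le (G := K) (n := K.size) le_rfl
  have := (ratGame_le_iff (isDyadic_natCast _).neg (isDyadic_natCast _).neg).1
    (le_trans _ _ _ h2 h')
  have h3 : (K.size : ℚ) < G.size := by exact_mod_cast hs
  linarith

theorem exists_isRightOption {G : ShortGame} (h : ¬ ∃ x, EqualsDyadic G x) :
    ∃ K, G.IsRightOption K := by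
  by_contra hno
  push Not at hno
  refine h (exists_equalsDyadic_of_fits (isDyadic_natCast G.size)
    (fun K hK h' => ?_) (fun K hK => absurd hK (hno K)))
  have hs := hK.size_lt
  have h2 := le_ratGame_of_size_le (G := K) (n := K.size) le_rfl
  have := (ratGame_le_iff (isDyadic_natCast _) (isDyadic_natCast _)).1
    (le_trans _ _ _ h' h2)
  have h3 : (K.size : ℚ) < G.size := by exact_mod_cast hs
  linarith

theorem EqualsDyadic.unique {G : ShortGame} {x y : ℚ} (hx : EqualsDyadic G x)
    (hy : EqualsDyadic G y) : x = y :=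
  le_antisymm ((ratGame_le_iff hx.1 hy.1).1 (le_trans _ _ _ hx.2.2 hy.2.1))
    ((ratGame_le_iff hy.1 hx.1).1 (le_trans _ _ _ hy.2.2 hx.2.1))

/-! ### Stops -/

theorem le_finMax {m : ℕ} (f : Fin m → ℚ) (i : Fin m) : f i ≤ finMax f := by
  rw [finMax, dif_pos ⟨i, Finset.mem_univ i⟩]
  exact Finset.le_sup' f (Finset.mem_univ i)

theorem exists_eq_finMax {m : ℕ} (f : Fin m → ℚ) (i : Fin m) : ∃ i, finMax f = f i := by
  have h : (Finset.univ : Finset (Fin m)).Nonempty := ⟨i, Finset.mem_univ i⟩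
  rw [finMax, dif_pos h]
  obtain ⟨j, -, hj⟩ := Finset.exists_mem_eq_sup' h f
  exact ⟨j, hj⟩

theorem finMin_le {m : ℕ} (f : Fin m → ℚ) (i : Fin m) : finMin f ≤ f i := by
  rw [finMin, dif_pos ⟨i, Finset.mem_univ i⟩]
  exact Finset.inf'_le f (Finset.mem_univ i)

theorem exists_eq_finMin {m : ℕ} (f : Fin m → ℚ) (i : Fin m) : ∃ i, finMin f = f i := by
  have h : (Finset.univ : Finset (Fin m)).Nonempty := ⟨i, Finset.mem_univ i⟩
  rw [finMin, dif_pos h]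
  obtain ⟨j, -, hj⟩ := Finset.exists_mem_eq_inf' h f
  exact ⟨j, hj⟩

theorem EqualsDyadic.stops_eq {G : ShortGame} {x : ℚ} (h : EqualsDyadic G x) :
    leftStop G = x ∧ rightStop G = x := by
  cases G with | mk L R =>
  have hex : ∃ x, EqualsDyadic (mk L R) x := ⟨x, h⟩
  have := hex.choose_spec.unique h
  rw [leftStop, rightStop, stops, dif_pos hex]
  exact ⟨this, this⟩

theorem stops_mk_eq {m n : ℕ} {L : Fin m → ShortGame} {R : Fin n → ShortGame}
    (h : ¬ ∃ x, EqualsDyadic (mk L R) x) :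
    leftStop (mk L R) = finMax (fun i => rightStop (L i)) ∧
      rightStop (mk L R) = finMin (fun j => leftStop (R j)) := by
  rw [leftStop, rightStop, stops, dif_neg h]
  exact ⟨rfl, rfl⟩

theorem IsLeftOption.rightStop_le {G K : ShortGame} (h : ¬ ∃ x, EqualsDyadic G x)
    (hK : G.IsLeftOption K) : rightStop K ≤ leftStop G := by
  cases G with | mk L R =>
  obtain ⟨i, rfl⟩ := hK
  rw [(stops_mk_eq h).1]
  exact le_finMax (fun i => rightStop (L i)) i

theorem IsRightOption.le_leftStop {G K : ShortGame} (h : ¬ ∃ x, EqualsDyadic G x)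
    (hK : G.IsRightOption K) : rightStop G ≤ leftStop K := by
  cases G with | mk L R =>
  obtain ⟨i, rfl⟩ := hK
  rw [(stops_mk_eq h).2]
  exact finMin_le (fun i => leftStop (R i)) i

theorem exists_leftStop_eq {G : ShortGame} (h : ¬ ∃ x, EqualsDyadic G x) :
    ∃ K, G.IsLeftOption K ∧ leftStop G = rightStop K := by
  obtain ⟨K, hK⟩ := exists_isLeftOption h
  cases G with | mk L R =>
  obtain ⟨i, rfl⟩ := hK
  obtain ⟨j, hj⟩ := exists_eq_finMax (fun i => rightStop (L i)) i
  exact ⟨L j, ⟨j, rfl⟩, by rw [(stops_mk_eq h).1, hj]⟩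

theorem exists_rightStop_eq {G : ShortGame} (h : ¬ ∃ x, EqualsDyadic G x) :
    ∃ K, G.IsRightOption K ∧ rightStop G = leftStop K := by
  obtain ⟨K, hK⟩ := exists_isRightOption h
  cases G with | mk L R =>
  obtain ⟨i, rfl⟩ := hK
  obtain ⟨j, hj⟩ := exists_eq_finMin (fun i => leftStop (R i)) i
  exact ⟨R j, ⟨j, rfl⟩, by rw [(stops_mk_eq h).2, hj]⟩

theorem isDyadic_stops (G : ShortGame) : IsDyadic (leftStop G) ∧ IsDyadic (rightStop G) := by
  induction hN : G.size using Nat.strong_induction_on generalizing G with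
  | _ N ih =>
  subst hN
  by_cases h : ∃ x, EqualsDyadic G x
  · obtain ⟨x, hx⟩ := h
    rw [hx.stops_eq.1, hx.stops_eq.2]
    exact ⟨hx.1, hx.1⟩
  · obtain ⟨K, hK, e1⟩ := exists_leftStop_eq h
    obtain ⟨K', hK', e2⟩ := exists_rightStop_eq h
    rw [e1, e2]
    exact ⟨(ih _ hK.size_lt K rfl).2, (ih _ hK'.size_lt K' rfl).1⟩

/-- The stops of a game bound it by numbers. -/
theorem stops_spec (G : ShortGame) :
    (∀ x, IsDyadic x → leftStop G < x → Le G (ratGame x) ∧ ¬ Le (ratGame x) G) ∧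
    (∀ x, IsDyadic x → rightStop G < x → ¬ Le (ratGame x) G) ∧
    (∀ x, IsDyadic x → x < rightStop G → Le (ratGame x) G ∧ ¬ Le G (ratGame x)) ∧
    (∀ x, IsDyadic x → x < leftStop G → ¬ Le G (ratGame x)) ∧
    rightStop G ≤ leftStop G := by
  induction hN : G.size using Nat.strong_induction_on generalizing G with
  | _ N ih =>
  subst hN
  by_cases h : ∃ x, EqualsDyadic G x
  · obtain ⟨y, hy⟩ := h
    rw [hy.stops_eq.1, hy.stops_eq.2]
    have up : ∀ x, IsDyadic x → y < x → Le G (ratGame x) ∧ ¬ Le (ratGame x) G := fun x hx hlt =>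
      ⟨le_trans _ _ _ hy.2.1 ((ratGame_le_iff hy.1 hx).2 hlt.le), fun h' =>
        absurd ((ratGame_le_iff hx hy.1).1 (le_trans _ _ _ h' hy.2.1)) (not_le.2 hlt)⟩
    have down : ∀ x, IsDyadic x → x < y → Le (ratGame x) G ∧ ¬ Le G (ratGame x) := fun x hx hlt =>
      ⟨le_trans _ _ _ ((ratGame_le_iff hx hy.1).2 hlt.le) hy.2.2, fun h' =>
        absurd ((ratGame_le_iff hy.1 hx).1 (le_trans _ _ _ hy.2.2 h')) (not_le.2 hlt)⟩
    exact ⟨up, fun x hx hlt => (up x hx hlt).2, down, fun x hx hlt => (down x hx hlt).2, le_rfl⟩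
  · have hb : ∀ x, IsDyadic x → rightStop G < x → ¬ Le (ratGame x) G := by
      intro x hx hlt h'
      obtain ⟨K, hK, e⟩ := exists_rightStop_eq h
      exact (le_iff.1 h').2 K hK ((ih _ hK.size_lt K rfl).1 x hx (e ▸ hlt)).1
    have hb' : ∀ x, IsDyadic x → x < leftStop G → ¬ Le G (ratGame x) := by
      intro x hx hlt h'
      obtain ⟨K, hK, e⟩ := exists_leftStop_eq h
      exact (le_iff.1 h').1 K hK ((ih _ hK.size_lt K rfl).2.2.1 x hx (e ▸ hlt)).1
    -- If the stops were in the wrong order, a dyadic strictly between them would fit between the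
    -- options and `G` would be a number.
    have hc : rightStop G ≤ leftStop G := by
      by_contra hlt
      obtain ⟨y, hy, h1, h2⟩ :=
        exists_isDyadic_between (isDyadic_stops G).1 (isDyadic_stops G).2 (not_le.1 hlt)
      exact h (exists_equalsDyadic_of_fits hy
        (fun K hK => (ih _ hK.size_lt K rfl).2.1 y hy ((hK.rightStop_le h).trans_lt h1))
        (fun K hK => (ih _ hK.size_lt K rfl).2.2.2.1 y hy (h2.trans_le (hK.le_leftStop h))))
    refine ⟨fun x hx hlt => ⟨le_iff.2 ⟨fun K hK => ?_, fun K hK => ?_⟩, ?_⟩, hb,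
      fun x hx hlt => ⟨le_iff.2 ⟨fun K hK => ?_, fun K hK => ?_⟩, ?_⟩, hb', hc⟩
    · exact (ih _ hK.size_lt K rfl).2.1 x hx ((hK.rightStop_le h).trans_lt hlt)
    · obtain ⟨-, rfl⟩ := (isRightOption_ratGame hx).1 hK
      have := inv_den_pos x
      exact hb _ (hx.add hx.inv_den) (by linarith)
    · exact hb x hx (hc.trans_lt hlt)
    · obtain ⟨-, rfl⟩ := (isLeftOption_ratGame hx).1 hK
      have := inv_den_pos x
      exact hb' _ (hx.sub hx.inv_den) (by linarith)
    · exact (ih _ hK.size_lt K rfl).2.2.2.1 x hx (hlt.trans_le (hK.le_leftStop h))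
    · exact hb' x hx (hlt.trans_le hc)

theorem rightStop_le_leftStop (G : ShortGame) : rightStop G ≤ leftStop G :=
  (stops_spec G).2.2.2.2

theorem le_ratGame_of_leftStop_lt {G : ShortGame} {x : ℚ} (hx : IsDyadic x)
    (h : leftStop G < x) : Le G (ratGame x) := ((stops_spec G).1 x hx h).1

theorem ratGame_le_of_lt_rightStop {G : ShortGame} {x : ℚ} (hx : IsDyadic x)
    (h : x < rightStop G) : Le (ratGame x) G := ((stops_spec G).2.2.1 x hx h).1

theorem leftStop_le_of_le {G : ShortGame} {x : ℚ} (hx : IsDyadic x)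
    (h : Le G (ratGame x)) : leftStop G ≤ x :=
  not_lt.1 fun hlt => (stops_spec G).2.2.2.1 x hx hlt h

theorem le_rightStop_of_le {G : ShortGame} {x : ℚ} (hx : IsDyadic x)
    (h : Le (ratGame x) G) : x ≤ rightStop G :=
  not_lt.1 fun hlt => (stops_spec G).2.1 x hx hlt h

theorem le_leftStop_of_not_le {G : ShortGame} {x : ℚ} (hx : IsDyadic x)
    (h : ¬ Le G (ratGame x)) : x ≤ leftStop G :=
  not_lt.1 fun hlt => h (le_ratGame_of_leftStop_lt hx hlt)

theorem rightStop_le_of_not_le {G : ShortGame} {x : ℚ} (hx : IsDyadic x)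
    (h : ¬ Le (ratGame x) G) : rightStop G ≤ x :=
  not_lt.1 fun hlt => h (ratGame_le_of_lt_rightStop hx hlt)

theorem leftStop_mono {G H : ShortGame} (h : Le G H) : leftStop G ≤ leftStop H := by
  by_contra hlt
  obtain ⟨z, hz, h1, h2⟩ :=
    exists_isDyadic_between (isDyadic_stops H).1 (isDyadic_stops G).1 (not_le.1 hlt)
  exact (stops_spec G).2.2.2.1 z hz h2 (le_trans _ _ _ h (le_ratGame_of_leftStop_lt hz h1))

theorem rightStop_mono {G H : ShortGame} (h : Le G H) : rightStop G ≤ rightStop H := by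
  by_contra hlt
  obtain ⟨z, hz, h1, h2⟩ :=
    exists_isDyadic_between (isDyadic_stops H).2 (isDyadic_stops G).2 (not_le.1 hlt)
  exact (stops_spec H).2.1 z hz h1 (le_trans _ _ _ (ratGame_le_of_lt_rightStop hz h2) h)

theorem Equal.leftStop_eq {G H : ShortGame} (h : Equal G H) : leftStop G = leftStop H :=
  le_antisymm (leftStop_mono h.1) (leftStop_mono h.2)

theorem Equal.rightStop_eq {G H : ShortGame} (h : Equal G H) : rightStop G = rightStop H :=
  le_antisymm (rightStop_mono h.1) (rightStop_mono h.2)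

/-! ### Translation of stops by a number. -/

theorem add_ratGame_sub_equal {z p : ℚ} (hz : IsDyadic z) (hp : IsDyadic p) :
    Equal (add (ratGame (z - p)) (ratGame p)) (ratGame z) := by
  have := add_ratGame_equal (hz.sub hp) hp
  rwa [sub_add_cancel] at this

theorem add_ratGame_le_iff {G : ShortGame} {z p : ℚ} (hz : IsDyadic z) (hp : IsDyadic p) :
    Le (add G (ratGame p)) (ratGame z) ↔ Le G (ratGame (z - p)) := by
  have e := add_ratGame_sub_equal hz hp
  rw [← add_le_add_right_iff G _ (ratGame p)]
  exact ⟨fun h => le_trans _ _ _ h e.2, fun h => le_trans _ _ _ h e.1⟩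

theorem le_add_ratGame_iff {G : ShortGame} {z p : ℚ} (hz : IsDyadic z) (hp : IsDyadic p) :
    Le (ratGame z) (add G (ratGame p)) ↔ Le (ratGame (z - p)) G := by
  have e := add_ratGame_sub_equal hz hp
  rw [← add_le_add_right_iff _ G (ratGame p)]
  exact ⟨fun h => le_trans _ _ _ e.1 h, fun h => le_trans _ _ _ e.2 h⟩

/-- Stops are determined by comparisons with numbers, and such comparisons are translated by adding
a number on both sides. -/
theorem leftStop_add_ratGame (G : ShortGame) {p : ℚ} (hp : IsDyadic p) :
    leftStop (add G (ratGame p)) = leftStop G + p := by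
  have d1 := (isDyadic_stops G).1.add hp
  have d2 := (isDyadic_stops (add G (ratGame p))).1
  apply le_antisymm <;> by_contra hlt
  · obtain ⟨z, hz, h1, h2⟩ := exists_isDyadic_between d1 d2 (not_le.1 hlt)
    refine (stops_spec _).2.2.2.1 z hz h2 ((add_ratGame_le_iff hz hp).2 ?_)
    exact le_ratGame_of_leftStop_lt (hz.sub hp) (by linarith)
  · obtain ⟨z, hz, h1, h2⟩ := exists_isDyadic_between d2 d1 (not_le.1 hlt)
    refine (stops_spec G).2.2.2.1 (z - p) (hz.sub hp) (by linarith) ?_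
    exact (add_ratGame_le_iff hz hp).1 (le_ratGame_of_leftStop_lt hz h1)

theorem rightStop_add_ratGame (G : ShortGame) {p : ℚ} (hp : IsDyadic p) :
    rightStop (add G (ratGame p)) = rightStop G + p := by
  have d1 := (isDyadic_stops G).2.add hp
  have d2 := (isDyadic_stops (add G (ratGame p))).2
  apply le_antisymm <;> by_contra hlt
  · obtain ⟨z, hz, h1, h2⟩ := exists_isDyadic_between d1 d2 (not_le.1 hlt)
    refine (stops_spec G).2.1 (z - p) (hz.sub hp) (by linarith) ?_
    exact (le_add_ratGame_iff hz hp).1 (ratGame_le_of_lt_rightStop hz h2)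
  · obtain ⟨z, hz, h1, h2⟩ := exists_isDyadic_between d2 d1 (not_le.1 hlt)
    refine (stops_spec _).2.1 z hz h1 ((le_add_ratGame_iff hz hp).2 ?_)
    exact ratGame_le_of_lt_rightStop (hz.sub hp) (by linarith)

/-! ### Walls of the thermograph of a form -/

/-- The Left wall of a form, as a function of the penalty. -/
noncomputable def lwall (G : ShortGame) (p : ℚ) : ℚ := leftStop (penalize G p)

/-- The Right wall of a form, as a function of the penalty. -/
noncomputable def rwall (G : ShortGame) (p : ℚ) : ℚ := rightStop (penalize G p)

/-- The options of a form, penalized by `p`, before freezing. -/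
noncomputable def preFreeze : ShortGame → ℚ → ShortGame
  | mk L R, p => mk (fun i => add (penalize (L i) p) (ratGame (-p)))
      (fun j => add (penalize (R j) p) (ratGame p))

/-- The Left scaffold. -/
noncomputable def lcand : ShortGame → ℚ → ℚ
  | mk L _, p => finMax fun i => rwall (L i) p - p

/-- The Right scaffold. -/
noncomputable def rcand : ShortGame → ℚ → ℚ
  | mk _ R, p => finMin fun j => lwall (R j) p + p

theorem penalize_eq (G : ShortGame) : penalize G = freeze (preFreeze G) := by
  cases G
  rw [penalize]
  rfl

theorem freeze_of_isFreezingPoint {F : ℚ → ShortGame} {t p : ℚ} (h : IsFreezingPoint F t) :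
    freeze F p = if t < p then ratGame (leftStop (F t)) else F p := by
  rw [freeze]
  split_ifs with h1 h2 h2
  · rw [h1.choose_spec.1.unique h]
  · have := h1.choose_spec
    rw [this.1.unique h] at this
    exact absurd this.2 h2
  · exact absurd ⟨t, h, h2⟩ h1
  · rfl

theorem freeze_zero (F : ℚ → ShortGame) : freeze F 0 = F 0 := by
  rw [freeze, dif_neg]
  rintro ⟨t, ht, h0⟩
  exact absurd ht.1.2.1 (not_le.2 h0)

theorem penalize_zero_equal (G : ShortGame) : Equal (penalize G 0) G := by
  induction G with
  | mk L R ihL ihR =>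
    rw [penalize_eq, freeze_zero, preFreeze]
    have e : ∀ X, Equal (add (penalize X 0) (ratGame 0)) (penalize X 0) := by
      intro X
      rw [ratGame_zero]
      exact add_zero_equal _
    simp only [neg_zero]
    exact ⟨le_of_options (fun i => ⟨i, ((e _).trans (ihL i)).1⟩)
        (fun i => ⟨i, ((e _).trans (ihR i)).1⟩),
      le_of_options (fun i => ⟨i, ((e _).trans (ihL i)).2⟩)
        (fun i => ⟨i, ((e _).trans (ihR i)).2⟩)⟩

theorem lwall_zero (G : ShortGame) : lwall G 0 = leftStop G := (penalize_zero_equal G).leftStop_eq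

theorem rwall_zero (G : ShortGame) : rwall G 0 = rightStop G := (penalize_zero_equal G).rightStop_eq

theorem rwall_le_lwall (G : ShortGame) (p : ℚ) : rwall G p ≤ lwall G p := rightStop_le_leftStop _

theorem equalsDyadic_ratGame {x : ℚ} (hx : IsDyadic x) : EqualsDyadic (ratGame x) x :=
  ⟨hx, Equal.refl _⟩

/-- At penalty 0 the stops already agree, so the form freezes there and both walls are vertical,
whatever its options look like. -/
theorem EqualsDyadic.walls {G : ShortGame} {x p : ℚ} (h : EqualsDyadic G x) (hp : 0 ≤ p) :
    lwall G p = x ∧ rwall G p = x := by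
  have h0 : leftStop (preFreeze G 0) = x ∧ rightStop (preFreeze G 0) = x := by
    rw [← freeze_zero (preFreeze G), ← penalize_eq]
    exact ⟨(lwall_zero G).trans h.stops_eq.1, (rwall_zero G).trans h.stops_eq.2⟩
  have hf : IsFreezingPoint (preFreeze G) 0 :=
    ⟨⟨isDyadic_zero, le_rfl, h0.1.trans h0.2.symm⟩, fun q hq => hq.2.1⟩
  rw [lwall, rwall, penalize_eq, freeze_of_isFreezingPoint hf]
  split_ifs with h1
  · rw [h0.1]
    exact (equalsDyadic_ratGame h.1).stops_eq
  · obtain rfl : p = 0 := le_antisymm (not_lt.1 h1) hp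
    exact h0

/-- The recursive formula for the stops survives even when the game is a number `x`: every Right
stop of a Left option is at most `x` and every Left stop of a Right option is at least `x`, so the
hypothesis squeezes both extremes to `x`. -/
theorem stops_mk_of_le {m n : ℕ} {L : Fin m → ShortGame} {R : Fin n → ShortGame}
    (i : Fin m) (j : Fin n)
    (h : finMin (fun j => leftStop (R j)) ≤ finMax (fun i => rightStop (L i))) :
    leftStop (mk L R) = finMax (fun i => rightStop (L i)) ∧
      rightStop (mk L R) = finMin (fun j => leftStop (R j)) := by
  by_cases hx : ∃ x, EqualsDyadic (mk L R) x
  · obtain ⟨x, hx⟩ := hx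
    obtain ⟨i', hi'⟩ := exists_eq_finMax (fun i => rightStop (L i)) i
    obtain ⟨j', hj'⟩ := exists_eq_finMin (fun j => leftStop (R j)) j
    have h1 : rightStop (L i') ≤ x := rightStop_le_of_not_le hx.1 fun h' =>
      not_le_left L R i' (le_trans _ _ _ hx.2.1 h')
    have h2 : x ≤ leftStop (R j') := le_leftStop_of_not_le hx.1 fun h' =>
      not_right_le L R j' (le_trans _ _ _ h' hx.2.2)
    rw [hi', hj'] at h ⊢
    rw [hx.stops_eq.1, hx.stops_eq.2]
    constructor <;> linarith
  · exact stops_mk_eq hx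

/-- Left and Right both have options. -/
def HasOptions (G : ShortGame) : Prop := (∃ K, G.IsLeftOption K) ∧ ∃ K, G.IsRightOption K

theorem stops_preFreeze {G : ShortGame} {p : ℚ} (hG : HasOptions G) (hp : IsDyadic p)
    (h : rcand G p ≤ lcand G p) :
    leftStop (preFreeze G p) = lcand G p ∧ rightStop (preFreeze G p) = rcand G p := by
  cases G with | mk L R =>
  obtain ⟨⟨_, i, -⟩, ⟨_, j, -⟩⟩ := hG
  have e1 : (fun i => rightStop (add (penalize (L i) p) (ratGame (-p)))) =
      fun i => rwall (L i) p - p := by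
    funext i
    rw [rightStop_add_ratGame _ hp.neg, sub_eq_add_neg]
    rfl
  have e2 : (fun j => leftStop (add (penalize (R j) p) (ratGame p))) =
      fun j => lwall (R j) p + p := by
    funext j
    rw [leftStop_add_ratGame _ hp]
    rfl
  have := stops_mk_of_le (L := fun i => add (penalize (L i) p) (ratGame (-p)))
    (R := fun j => add (penalize (R j) p) (ratGame p)) i j
  rw [e1, e2] at this
  exact this h

/-- `t` is the point where the two scaffolds of `G` first meet. -/
structure IsTemp (G : ShortGame) (t : ℚ) : Prop where
  dyadic : IsDyadic t
  nonneg : 0 ≤ t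
  lt : ∀ q, IsDyadic q → 0 ≤ q → q < t → rcand G q < lcand G q
  eq : lcand G t = rcand G t

/-- Up to `t` the scaffolds have not crossed, so they are the actual stops and `t` is the freezing
point; beyond it the walls keep their common value at `t`. Hence the argument `min p t`. -/
theorem IsTemp.walls {G : ShortGame} {t p : ℚ} (h : IsTemp G t) (hG : HasOptions G)
    (hp : IsDyadic p) (hp0 : 0 ≤ p) :
    lwall G p = lcand G (min p t) ∧ rwall G p = rcand G (min p t) := by
  have hle : ∀ q, IsDyadic q → 0 ≤ q → q ≤ t → rcand G q ≤ lcand G q := by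
    intro q hq hq0 hqt
    rcases hqt.lt_or_eq with h1 | rfl
    · exact (h.lt q hq hq0 h1).le
    · exact h.eq.ge
  have ht := stops_preFreeze hG h.dyadic (hle t h.dyadic h.nonneg le_rfl)
  have hf : IsFreezingPoint (preFreeze G) t := by
    refine ⟨⟨h.dyadic, h.nonneg, by rw [ht.1, ht.2, h.eq]⟩, fun q ⟨hq, hq0, he⟩ => ?_⟩
    by_contra hlt
    have h1 := h.lt q hq hq0 (not_le.1 hlt)
    have h2 := stops_preFreeze hG hq h1.le
    rw [h2.1, h2.2] at he
    exact h1.ne' he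
  rw [lwall, rwall, penalize_eq, freeze_of_isFreezingPoint hf]
  split_ifs with h1
  · rw [min_eq_right h1.le, ← h.eq, ht.1]
    exact (equalsDyadic_ratGame (ht.1 ▸ (isDyadic_stops _).1)).stops_eq
  · rw [min_eq_left (not_lt.1 h1)]
    exact stops_preFreeze hG hp (hle p hp hp0 (not_lt.1 h1))

theorem IsLeftOption.le_lcand {G K : ShortGame} (h : G.IsLeftOption K) (p : ℚ) :
    rwall K p - p ≤ lcand G p := by
  cases G
  obtain ⟨i, rfl⟩ := h
  exact le_finMax (fun i => rwall _ p - p) i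

theorem IsRightOption.rcand_le {G K : ShortGame} (h : G.IsRightOption K) (p : ℚ) :
    rcand G p ≤ lwall K p + p := by
  cases G
  obtain ⟨i, rfl⟩ := h
  exact finMin_le (fun i => lwall _ p + p) i

theorem HasOptions.exists_lcand_eq {G : ShortGame} (h : HasOptions G) (p : ℚ) :
    ∃ K, G.IsLeftOption K ∧ lcand G p = rwall K p - p := by
  cases G with | mk L R =>
  obtain ⟨⟨_, i, -⟩, -⟩ := h
  obtain ⟨j, hj⟩ := exists_eq_finMax (fun i => rwall (L i) p - p) i
  exact ⟨L j, ⟨j, rfl⟩, hj⟩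

theorem HasOptions.exists_rcand_eq {G : ShortGame} (h : HasOptions G) (p : ℚ) :
    ∃ K, G.IsRightOption K ∧ rcand G p = lwall K p + p := by
  cases G with | mk L R =>
  obtain ⟨-, ⟨_, i, -⟩⟩ := h
  obtain ⟨j, hj⟩ := exists_eq_finMin (fun i => lwall (R i) p + p) i
  exact ⟨R j, ⟨j, rfl⟩, hj⟩

theorem hasOptions_of_not_equalsDyadic {G : ShortGame} (h : ¬ ∃ x, EqualsDyadic G x) :
    HasOptions G := ⟨exists_isLeftOption h, exists_isRightOption h⟩

/-! ### Piecewise linear functions with slopes `0` and `-1` and dyadic breakpoints -/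

/-- On the dyadics `p ≥ 0`, the function `f` is antitone and `1`-Lipschitz, and it maps every
dyadic grid of mesh at most `2⁻ᴺ` to itself.  In other words, it is piecewise linear with slopes
`0` and `-1` and with breakpoints in the grid of mesh `2⁻ᴺ`. -/
structure Cool (N : ℕ) (f : ℚ → ℚ) : Prop where
  anti : ∀ p q, IsDyadic p → IsDyadic q → 0 ≤ p → p ≤ q → f q ≤ f p
  lip : ∀ p q, IsDyadic p → IsDyadic q → 0 ≤ p → p ≤ q → f p - (q - p) ≤ f q
  grid : ∀ M, N ≤ M → ∀ k : ℕ, ∃ z : ℤ, f (k / 2 ^ M) = z / 2 ^ M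

theorem isDyadic_grid (k M : ℕ) : IsDyadic ((k : ℚ) / 2 ^ M) := ⟨k, M, by simp⟩

theorem grid_nonneg (k M : ℕ) : 0 ≤ (k : ℚ) / 2 ^ M := by positivity

theorem Cool.mono {N N' : ℕ} {f : ℚ → ℚ} (h : Cool N f) (hN : N ≤ N') : Cool N' f :=
  ⟨h.anti, h.lip, fun M hM => h.grid M (hN.trans hM)⟩

theorem Cool.congr {N : ℕ} {f g : ℚ → ℚ} (h : Cool N f)
    (e : ∀ p, IsDyadic p → 0 ≤ p → g p = f p) : Cool N g := by
  refine ⟨fun p q hp hq h0 hpq => ?_, fun p q hp hq h0 hpq => ?_, fun M hM k => ?_⟩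
  · rw [e p hp h0, e q hq (h0.trans hpq)]
    exact h.anti p q hp hq h0 hpq
  · rw [e p hp h0, e q hq (h0.trans hpq)]
    exact h.lip p q hp hq h0 hpq
  · rw [e _ (isDyadic_grid k M) (grid_nonneg k M)]
    exact h.grid M hM k

theorem IsDyadic.exists_cool_const {x : ℚ} (hx : IsDyadic x) : ∃ N, Cool N fun _ => x := by
  obtain ⟨n, hn⟩ := hx.exists_den
  exact ⟨n, fun _ _ _ _ _ _ => le_rfl, fun _ _ _ _ _ h => by linarith,
    fun M hM _ => exists_intCast_div hn hM⟩

/-- Right walls have slopes 0 and 1. Subtracting `p` shifts the slopes to -1 and 0, and a maximum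
preserves this. The hypothesis is on `-f i` because `Cool` describes nonincreasing functions. -/
theorem Cool.finMax_sub {N m : ℕ} {f : Fin m → ℚ → ℚ} (i : Fin m)
    (h : ∀ i, Cool N fun p => - f i p) : Cool N fun p => finMax fun i => f i p - p := by
  refine ⟨fun p q hp hq h0 hpq => ?_, fun p q hp hq h0 hpq => ?_, fun M hM k => ?_⟩
  · obtain ⟨j, hj⟩ := exists_eq_finMax (fun i => f i q - q) i
    refine _root_.le_trans ?_ (le_finMax (fun i => f i p - p) j)
    have := (h j).lip p q hp hq h0 hpq
    linarith
  · obtain ⟨j, hj⟩ := exists_eq_finMax (fun i => f i p - p) i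
    refine _root_.le_trans ?_ (le_finMax (fun i => f i q - q) j)
    have := (h j).anti p q hp hq h0 hpq
    linarith
  · obtain ⟨j, hj⟩ := exists_eq_finMax (fun i => f i (k / 2 ^ M) - k / 2 ^ M) i
    obtain ⟨z, hz⟩ := (h j).grid M hM k
    refine ⟨-z - k, hj.trans ?_⟩
    push_cast
    linear_combination -hz

theorem Cool.neg_finMin_add {N m : ℕ} {f : Fin m → ℚ → ℚ} (i : Fin m)
    (h : ∀ i, Cool N (f i)) : Cool N fun p => - finMin fun i => f i p + p := by
  refine ⟨fun p q hp hq h0 hpq => ?_, fun p q hp hq h0 hpq => ?_, fun M hM k => ?_⟩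
  · obtain ⟨j, hj⟩ := exists_eq_finMin (fun i => f i q + q) i
    refine neg_le_neg (_root_.le_trans (finMin_le (fun i => f i p + p) j) ?_)
    have := (h j).lip p q hp hq h0 hpq
    linarith
  · obtain ⟨j, hj⟩ := exists_eq_finMin (fun i => f i p + p) i
    have h1 := finMin_le (fun i => f i q + q) j
    have := (h j).anti p q hp hq h0 hpq
    linarith
  · obtain ⟨j, hj⟩ := exists_eq_finMin (fun i => f i (k / 2 ^ M) + k / 2 ^ M) i
    obtain ⟨z, hz⟩ := (h j).grid M hM k
    refine ⟨-z - k, ?_⟩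
    rw [hj, hz]
    push_cast
    ring

/-- This is the effect of freezing on a scaffold. The freezing point may be a midpoint of the old
grid, which is why the mesh is halved. -/
theorem Cool.comp_min {N k : ℕ} {f : ℚ → ℚ} (h : Cool N f) :
    Cool (N + 1) fun p => f (min p (k / 2 ^ (N + 1))) := by
  have ht := isDyadic_grid k (N + 1)
  have ht0 := grid_nonneg k (N + 1)
  set t : ℚ := k / 2 ^ (N + 1) with htd
  refine ⟨fun p q hp hq h0 hpq => ?_, fun p q hp hq h0 hpq => ?_, fun M hM j => ?_⟩
  · exact h.anti _ _ (hp.min ht) (hq.min ht) (le_min h0 ht0) (min_le_min_right t hpq)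
  · have h1 := h.lip _ _ (hp.min ht) (hq.min ht) (le_min h0 ht0) (min_le_min_right t hpq)
    have h2 : min q t - min p t ≤ q - p := by
      rcases min_cases p t with ⟨h3, h4⟩ | ⟨h3, h4⟩ <;>
        rcases min_cases q t with ⟨h5, h6⟩ | ⟨h5, h6⟩ <;> linarith
    linarith
  · rcases min_choice ((j : ℚ) / 2 ^ M) t with h1 | h1
    · simp only [h1]
      exact h.grid M (by omega) j
    · simp only [h1]
      obtain ⟨d, rfl⟩ := Nat.exists_eq_add_of_le hM
      have e : t = ((k * 2 ^ d : ℕ) : ℚ) / 2 ^ (N + 1 + d) := by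
        rw [htd, pow_add]
        push_cast
        field_simp
        ring
      rw [e]
      exact h.grid _ (by omega) _

/-- With `f` the Left scaffold and `g` the negated Right one, `f + g` is the gap between the
scaffolds. On each cell of mesh `u = 1 / 2 ^ N` it is linear with slope 0, -1 or -2 and starts at a
multiple of `u`, so its first zero is a grid point or the midpoint of a cell, in particular a
dyadic. -/
theorem Cool.exists_crossing {N : ℕ} {f g : ℚ → ℚ} (hf : Cool N f) (hg : Cool N g)
    (h0 : 0 ≤ f 0 + g 0) {P : ℕ} (hP : f P + g P ≤ 0) :
    ∃ k : ℕ, f (k / 2 ^ (N + 1)) + g (k / 2 ^ (N + 1)) = 0 ∧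
      ∀ q, IsDyadic q → 0 ≤ q → q < k / 2 ^ (N + 1) → 0 < f q + g q := by
  classical
  set u : ℚ := 1 / 2 ^ N with hu
  have hu0 : 0 < u := by positivity
  have hgrid : ∀ k : ℕ, (k : ℚ) / 2 ^ N = k * u := fun k => by rw [hu]; ring
  have hdy : ∀ k : ℕ, IsDyadic (k * u) := fun k => hgrid k ▸ isDyadic_grid k N
  have hhalf : ∀ k : ℕ, (k : ℚ) / 2 ^ (N + 1) = k * u / 2 := fun k => by
    rw [hu, pow_succ]
    field_simp
  have hgr : ∀ {F : ℚ → ℚ}, Cool N F → ∀ k : ℕ, ∃ z : ℤ, F (k * u) = z * u := by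
    intro F hF k
    obtain ⟨z, hz⟩ := hF.grid N le_rfl k
    exact ⟨z, by rw [← hgrid, hz, hu]; ring⟩
  -- The first grid point with nonpositive gap ends the cell that contains the crossing.
  have hex : ∃ k : ℕ, f (k * u) + g (k * u) ≤ 0 := by
    refine ⟨P * 2 ^ N, ?_⟩
    have : ((P * 2 ^ N : ℕ) : ℚ) * u = P := by
      rw [hu]
      push_cast
      field_simp
    rwa [this]
  cases hk : Nat.find hex with
  | zero =>
    have h1 := Nat.find_spec hex
    rw [hk] at h1
    refine ⟨0, ?_, fun q _ hq0 hq => ?_⟩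
    · simp at h1 ⊢
      linarith
    · simp at hq
      linarith
  | succ k =>
    have h1 := Nat.find_spec hex
    have h2 := Nat.find_min hex (m := k) (by omega)
    rw [hk] at h1
    rw [not_le] at h2
    set x : ℚ := k * u with hx
    have hx0 : 0 ≤ x := by positivity
    have hxu : ((k + 1 : ℕ) : ℚ) * u = x + u := by rw [hx]; push_cast; ring
    have hdx := hdy k
    have hdu := hdy (k + 1)
    rw [hxu] at h1 hdu
    -- Across one cell the function drops by 0 or by `u`. Monotonicity in the first case and the
    -- Lipschitz bound in the second force it to be linear in between.
    have lin : ∀ {F : ℚ → ℚ}, Cool N F → ∃ a s : ℤ, (s = 0 ∨ s = 1) ∧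
        ∀ q, IsDyadic q → x ≤ q → q ≤ x + u → F q = a * u - s * (q - x) := by
      intro F hF
      obtain ⟨a, ha⟩ := hgr hF k
      obtain ⟨b, hb⟩ := hgr hF (k + 1)
      rw [hxu] at hb
      have e1 := hF.anti x (x + u) hdx hdu hx0 (by linarith)
      have e2 := hF.lip x (x + u) hdx hdu hx0 (by linarith)
      rw [← hx] at ha
      rw [ha, hb] at e1 e2
      have e3 : b ≤ a := by
        have := le_of_mul_le_mul_right e1 hu0
        exact_mod_cast this
      have e4 : a - 1 ≤ b := by
        have : ((a - 1 : ℤ) : ℚ) * u ≤ b * u := by push_cast; linarith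
        exact_mod_cast le_of_mul_le_mul_right this hu0
      refine ⟨a, a - b, by omega, fun q hq hxq hqu => ?_⟩
      have f1 := hF.anti x q hdx hq hx0 hxq
      have f2 := hF.lip x q hdx hq hx0 hxq
      have f3 := hF.anti q (x + u) hq hdu (hx0.trans hxq) hqu
      have f4 := hF.lip q (x + u) hq hdu (hx0.trans hxq) hqu
      rw [ha] at f1 f2
      rw [hb] at f3 f4
      obtain rfl | rfl : b = a ∨ b = a - 1 := by omega
      · push_cast
        linarith
      · push_cast at f3 f4 ⊢
        linarith
    obtain ⟨a, s, hs, hfl⟩ := lin hf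
    obtain ⟨b, r, hr, hgl⟩ := lin hg
    have hlin : ∀ q, IsDyadic q → x ≤ q → q ≤ x + u →
        f q + g q = ((a + b : ℤ) : ℚ) * u - ((s + r : ℤ) : ℚ) * (q - x) := by
      intro q hq h3 h4
      rw [hfl q hq h3 h4, hgl q hq h3 h4]
      push_cast
      ring
    have before : ∀ q, IsDyadic q → 0 ≤ q → q ≤ x → 0 < f q + g q := by
      intro q hq hq0 hqx
      have := hf.anti q x hq hdx hq0 hqx
      have := hg.anti q x hq hdx hq0 hqx
      linarith
    rw [hlin x hdx le_rfl (by linarith), sub_self, mul_zero, sub_zero] at h2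
    rw [hlin _ hdu (by linarith) le_rfl, add_sub_cancel_left] at h1
    have hpos : 0 < a + b := by
      have := pos_of_mul_pos_left h2 hu0.le
      exact_mod_cast this
    have hle : a + b ≤ s + r := by
      have : ((a + b : ℤ) : ℚ) * u ≤ ((s + r : ℤ) : ℚ) * u := by linarith
      exact_mod_cast le_of_mul_le_mul_right this hu0
    have fin : ∀ j : ℕ, x < j * u / 2 → (j : ℚ) * u / 2 ≤ x + u →
        ((a + b : ℤ) : ℚ) * u = ((s + r : ℤ) : ℚ) * (j * u / 2 - x) →
        ∃ k : ℕ, f (k / 2 ^ (N + 1)) + g (k / 2 ^ (N + 1)) = 0 ∧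
          ∀ q, IsDyadic q → 0 ≤ q → q < k / 2 ^ (N + 1) → 0 < f q + g q := by
      intro j h3 h4 h5
      refine ⟨j, ?_, fun q hq hq0 hqj => ?_⟩
      · rw [hlin _ (isDyadic_grid j _) (by rw [hhalf]; exact h3.le) (by rw [hhalf]; exact h4),
          hhalf, h5, sub_self]
      · rw [hhalf] at hqj
        rcases le_total q x with h6 | h6
        · exact before q hq hq0 h6
        · rw [hlin q hq h6 (by linarith), h5, ← mul_sub]
          have : (0 : ℚ) < ((s + r : ℤ) : ℚ) := by
            have : 0 < s + r := by omega
            exact_mod_cast this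
          apply mul_pos this
          linarith
    -- Here `0 < a + b ≤ s + r ≤ 2`. The zero is the right end of the cell if `a + b = s + r`, and
    -- its midpoint if the gap `u` is closed with slope -2.
    obtain h3 | ⟨h3, h4⟩ : a + b = s + r ∨ a + b = 1 ∧ s + r = 2 := by omega
    · refine fin (2 * (k + 1)) ?_ ?_ ?_
      · push_cast; linarith
      · push_cast; linarith
      · rw [h3]; push_cast; rw [hx]; ring
    · refine fin (2 * k + 1) ?_ ?_ ?_
      · push_cast; linarith
      · push_cast; linarith
      · rw [h3, h4]; push_cast; rw [hx]; ring

theorem rcand_zero_le {G : ShortGame} (h : ¬ ∃ x, EqualsDyadic G x) :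
    rcand G 0 ≤ lcand G 0 := by
  have h1 : leftStop G = lcand G 0 ∧ rightStop G = rcand G 0 := by
    cases G with | mk L R =>
    have := stops_mk_eq h
    rw [this.1, this.2]
    simp [lcand, rcand, lwall_zero, rwall_zero]
  rw [← h1.1, ← h1.2]
  exact rightStop_le_leftStop G

/-- Both walls of a form are piecewise linear, and its scaffolds meet unless it is a number. -/
theorem exists_cool_walls (G : ShortGame) :
    (∃ N, Cool N (lwall G) ∧ Cool N fun p => - rwall G p) ∧
    ((∃ x, EqualsDyadic G x) ∨ HasOptions G ∧ (∃ t, IsTemp G t) ∧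
      ∃ N, Cool N (lcand G) ∧ Cool N fun p => - rcand G p) := by
  induction G with
  | mk L R ihL ihR =>
    by_cases hnum : ∃ x, EqualsDyadic (mk L R) x
    · refine ⟨?_, Or.inl hnum⟩
      obtain ⟨x, hx⟩ := hnum
      obtain ⟨N, hN⟩ := hx.1.exists_cool_const
      obtain ⟨N', hN'⟩ := hx.1.neg.exists_cool_const
      exact ⟨max N N', (hN.mono (le_max_left _ _)).congr fun p _ hp0 => (hx.walls hp0).1,
        (hN'.mono (le_max_right _ _)).congr fun p _ hp0 => by rw [(hx.walls hp0).2]⟩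
    have hopt := hasOptions_of_not_equalsDyadic hnum
    obtain ⟨⟨_, i, -⟩, ⟨_, j, -⟩⟩ := id hopt
    choose n hn using fun i => (ihL i).1
    choose n' hn' using fun i => (ihR i).1
    set N := max (Finset.univ.sup n) (Finset.univ.sup n') with hN
    have hl : Cool N (lcand (mk L R)) := Cool.finMax_sub (f := fun i => rwall (L i)) i fun i =>
      (hn i).2.mono ((Finset.le_sup (Finset.mem_univ i)).trans (le_max_left _ _))
    have hr : Cool N fun p => - rcand (mk L R) p :=
      Cool.neg_finMin_add (f := fun i => lwall (R i)) j fun i =>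
        (hn' i).1.mono ((Finset.le_sup (Finset.mem_univ i)).trans (le_max_right _ _))
    -- The walls of the options are bounded by their values at penalty 0, so a large enough penalty
    -- pushes the scaffolds past each other.
    obtain ⟨P, hP⟩ : ∃ P : ℕ, lcand (mk L R) P + - rcand (mk L R) P ≤ 0 := by
      obtain ⟨P, hP⟩ := exists_nat_ge
        (finMax (fun i => lwall (L i) 0) - finMin (fun j => rwall (R j) 0))
      have hP0 : (0 : ℚ) ≤ P := by positivity
      refine ⟨P, ?_⟩
      obtain ⟨_, ⟨i', rfl⟩, e1⟩ := hopt.exists_lcand_eq P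
      obtain ⟨_, ⟨j', rfl⟩, e2⟩ := hopt.exists_rcand_eq P
      have h1 := (hn i').1.anti 0 P isDyadic_zero (isDyadic_natCast P) le_rfl hP0
      have h2 := (hn' j').2.anti 0 P isDyadic_zero (isDyadic_natCast P) le_rfl hP0
      have h3 := le_finMax (fun i => lwall (L i) 0) i'
      have h4 := finMin_le (fun i => rwall (R i) 0) j'
      have h5 := rwall_le_lwall (L i') P
      have h6 := rwall_le_lwall (R j') P
      rw [e1, e2]
      linarith
    obtain ⟨k, hk, hlt⟩ := hl.exists_crossing hr
      (by have := rcand_zero_le hnum; linarith) hP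
    have ht : IsTemp (mk L R) (k / 2 ^ (N + 1)) :=
      ⟨isDyadic_grid _ _, grid_nonneg _ _, fun q hq hq0 hqt => by
        have := hlt q hq hq0 hqt
        linarith, by linarith⟩
    refine ⟨⟨N + 1, (hl.comp_min (k := k)).congr fun p hp hp0 => (ht.walls hopt hp hp0).1,
      (hr.comp_min (k := k)).congr fun p hp hp0 => by rw [(ht.walls hopt hp hp0).2]⟩,
      Or.inr ⟨hopt, ⟨_, ht⟩, N, hl, hr⟩⟩

theorem lwall_anti (G : ShortGame) {p q : ℚ} (hp : IsDyadic p) (hq : IsDyadic q) (h0 : 0 ≤ p)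
    (h : p ≤ q) : lwall G q ≤ lwall G p := by
  obtain ⟨⟨N, h1, -⟩, -⟩ := exists_cool_walls G
  exact h1.anti p q hp hq h0 h

theorem lwall_lip (G : ShortGame) {p q : ℚ} (hp : IsDyadic p) (hq : IsDyadic q) (h0 : 0 ≤ p)
    (h : p ≤ q) : lwall G p ≤ lwall G q + (q - p) := by
  obtain ⟨⟨N, h1, -⟩, -⟩ := exists_cool_walls G
  have := h1.lip p q hp hq h0 h
  linarith

theorem rwall_mono (G : ShortGame) {p q : ℚ} (hp : IsDyadic p) (hq : IsDyadic q) (h0 : 0 ≤ p)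
    (h : p ≤ q) : rwall G p ≤ rwall G q := by
  obtain ⟨⟨N, -, h1⟩, -⟩ := exists_cool_walls G
  have := h1.anti p q hp hq h0 h
  linarith

theorem rwall_lip (G : ShortGame) {p q : ℚ} (hp : IsDyadic p) (hq : IsDyadic q) (h0 : 0 ≤ p)
    (h : p ≤ q) : rwall G q ≤ rwall G p + (q - p) := by
  obtain ⟨⟨N, -, h1⟩, -⟩ := exists_cool_walls G
  have := h1.lip p q hp hq h0 h
  linarith

/-! ### Walls depend only on the value -/

/-- The bound persists above the freezing point, where the wall is no longer the scaffold: the Right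
scaffold is nondecreasing, so freezing leaves the wall below it. For a number `x`, use `x ≤ leftStop
K` and the Lipschitz bound on the Left wall of `K`. -/
theorem IsRightOption.rwall_le {G K : ShortGame} (h : G.IsRightOption K) {p : ℚ} (hp : IsDyadic p)
    (h0 : 0 ≤ p) : rwall G p ≤ lwall K p + p := by
  obtain ⟨-, ⟨x, hx⟩ | ⟨hopt, ⟨t, ht⟩, N, -, hc⟩⟩ := exists_cool_walls G
  · rw [(hx.walls h0).2]
    have h1 : x ≤ leftStop K := le_leftStop_of_not_le hx.1 fun h' =>
      h.not_le (le_trans _ _ _ h' hx.2.2)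
    have h2 := lwall_lip K isDyadic_zero hp le_rfl h0
    rw [lwall_zero] at h2
    linarith
  · rw [(ht.walls hopt hp h0).2]
    have := hc.anti (min p t) p (hp.min ht.dyadic) hp (le_min h0 ht.nonneg) (min_le_left _ _)
    have := h.rcand_le p
    linarith

theorem IsLeftOption.le_lwall {G K : ShortGame} (h : G.IsLeftOption K) {p : ℚ} (hp : IsDyadic p)
    (h0 : 0 ≤ p) : rwall K p - p ≤ lwall G p := by
  obtain ⟨-, ⟨x, hx⟩ | ⟨hopt, ⟨t, ht⟩, N, hc, -⟩⟩ := exists_cool_walls G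
  · rw [(hx.walls h0).1]
    have h1 : rightStop K ≤ x := rightStop_le_of_not_le hx.1 fun h' =>
      h.not_le (le_trans _ _ _ hx.2.1 h')
    have h2 := rwall_lip K isDyadic_zero hp le_rfl h0
    rw [rwall_zero] at h2
    linarith
  · rw [(ht.walls hopt hp h0).1]
    have := hc.anti (min p t) p (hp.min ht.dyadic) hp (le_min h0 ht.nonneg) (min_le_left _ _)
    have := h.le_lcand p
    linarith

theorem IsTemp.frozen {G : ShortGame} {t p : ℚ} (h : IsTemp G t) (hG : HasOptions G)
    (hp : IsDyadic p) (htp : t ≤ p) :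
    lwall G p = lwall G t ∧ rwall G p = lwall G t ∧ rwall G t = lwall G t := by
  have h1 := h.walls hG hp (h.nonneg.trans htp)
  have h2 := h.walls hG h.dyadic h.nonneg
  rw [min_eq_right htp] at h1
  rw [min_self] at h2
  rw [h1.1, h1.2, h2.1, h2.2]
  exact ⟨rfl, h.eq.symm, h.eq.symm⟩

/-- Below the freezing point of `G`, its Left wall comes from some Left option `K`. Since `H ≤ K`
fails, either `K` is at most a Left option of `H`, or a Right option of `K` is at most `H`; both
cases bound the wall by induction. The Right walls are dual. Above freezing points the comparison is
transferred along the vertical masts. Applied in both directions to equal games, this makes walls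
invariants of the value. -/
theorem walls_mono (G H : ShortGame) (hGH : Le G H) {p : ℚ} (hp : IsDyadic p) (h0 : 0 ≤ p) :
    lwall G p ≤ lwall H p ∧ rwall G p ≤ rwall H p := by
  induction hN : G.size + H.size using Nat.strong_induction_on generalizing G H p with
  | _ N ih =>
  subst hN
  obtain ⟨-, ⟨x, hx⟩ | ⟨optG, ⟨t, ht⟩, -⟩⟩ := exists_cool_walls G
  · have h1 : x ≤ rwall H 0 := by
      rw [rwall_zero]
      exact le_rightStop_of_le hx.1 (le_trans _ _ _ hx.2.2 hGH)
    have h2 := rwall_mono H isDyadic_zero hp le_rfl h0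
    have h3 := rwall_le_lwall H p
    rw [(hx.walls h0).1, (hx.walls h0).2]
    constructor <;> linarith
  obtain ⟨-, ⟨x, hx⟩ | ⟨optH, ⟨s, hs⟩, -⟩⟩ := exists_cool_walls H
  · have h1 : lwall G 0 ≤ x := by
      rw [lwall_zero]
      exact leftStop_le_of_le hx.1 (le_trans _ _ _ hGH hx.2.1)
    have h2 := lwall_anti G isDyadic_zero hp le_rfl h0
    have h3 := rwall_le_lwall G p
    rw [(hx.walls h0).1, (hx.walls h0).2]
    constructor <;> linarith
  have left : ∀ p, IsDyadic p → 0 ≤ p → p ≤ t → lwall G p ≤ lwall H p := by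
    intro p hp h0 hpt
    obtain ⟨K, hK, e⟩ := optG.exists_lcand_eq p
    rw [(ht.walls optG hp h0).1, min_eq_left hpt, e]
    have hs := hK.size_lt
    obtain ⟨X, hX, h1⟩ | ⟨X, hX, h1⟩ := not_le_iff.1 ((le_iff.1 hGH).1 K hK)
    · have hs' := hX.size_lt
      have h2 := (ih _ (by omega) K X h1 hp h0 rfl).2
      have h3 := hX.le_lwall hp h0
      linarith
    · have hs' := hX.size_lt
      have h2 := (ih _ (by omega) X H h1 hp h0 rfl).1
      have h3 := hX.rwall_le hp h0
      linarith
  have right : ∀ p, IsDyadic p → 0 ≤ p → p ≤ s → rwall G p ≤ rwall H p := by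
    intro p hp h0 hps
    obtain ⟨K, hK, e⟩ := optH.exists_rcand_eq p
    rw [(hs.walls optH hp h0).2, min_eq_left hps, e]
    have hsz := hK.size_lt
    obtain ⟨X, hX, h1⟩ | ⟨X, hX, h1⟩ := not_le_iff.1 ((le_iff.1 hGH).2 K hK)
    · have hs' := hX.size_lt
      have h2 := (ih _ (by omega) G X h1 hp h0 rfl).2
      have h3 := hX.le_lwall hp h0
      linarith
    · have hs' := hX.size_lt
      have h2 := (ih _ (by omega) X K h1 hp h0 rfl).1
      have h3 := hX.rwall_le hp h0
      linarith
  have gl := rwall_le_lwall G p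
  have hl := rwall_le_lwall H p
  have mG : t ≤ p → rwall G t ≤ rwall H p → lwall G p ≤ rwall H p ∧ rwall G p ≤ rwall H p := by
    intro h1 h2
    obtain ⟨e1, e2, e3⟩ := ht.frozen optG hp h1
    rw [e1, e2, ← e3]
    exact ⟨h2, h2⟩
  rcases le_total p t with h1 | h1 <;> rcases le_total p s with h2 | h2
  · exact ⟨left p hp h0 h1, right p hp h0 h2⟩
  · have h3 := left p hp h0 h1
    obtain ⟨e1, e2, e3⟩ := hs.frozen optH hp h2
    exact ⟨h3, by linarith⟩
  · have h3 := right p hp h0 h2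
    obtain ⟨e1, e2, e3⟩ := ht.frozen optG hp h1
    exact ⟨by linarith, h3⟩
  · obtain ⟨e1, e2, e3⟩ := ht.frozen optG hp h1
    obtain ⟨f1, f2, f3⟩ := hs.frozen optH hp h2
    -- Both games are frozen. At the larger of the two freezing points one is already on its mast
    -- and the other is still governed by its scaffold, so a comparison proved above applies.
    rcases le_total t s with h3 | h3
    · have h4 := right s hs.dyadic hs.nonneg le_rfl
      obtain ⟨g1, g2, g3⟩ := ht.frozen optG hs.dyadic h3
      constructor <;> linarith
    · have h4 := left t ht.dyadic ht.nonneg le_rfl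
      obtain ⟨g1, g2, g3⟩ := hs.frozen optH ht.dyadic h3
      constructor <;> linarith

theorem Equal.walls_eq {G H : ShortGame} (h : Equal G H) {p : ℚ} (hp : IsDyadic p)
    (h0 : 0 ≤ p) : lwall G p = lwall H p ∧ rwall G p = rwall H p :=
  ⟨le_antisymm (walls_mono G H h.1 hp h0).1 (walls_mono H G h.2 hp h0).1,
    le_antisymm (walls_mono G H h.1 hp h0).2 (walls_mono H G h.2 hp h0).2⟩

/-- Thermographs can be computed from arbitrary forms. -/
theorem thermograph_eq_of_walls_eq {G H : ShortGame}
    (h : ∀ p, IsDyadic p → 0 ≤ p → lwall G p = lwall H p ∧ rwall G p = rwall H p) :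
    thermograph G = thermograph H := by
  have e : ∀ p, IsDyadic p → 0 ≤ p →
      leftStop (penalize (canonicalForm G) p) = leftStop (penalize (canonicalForm H) p) ∧
      rightStop (penalize (canonicalForm G) p) = rightStop (penalize (canonicalForm H) p) := by
    intro p hp h0
    have h1 := (canonicalForm_spec G).2.walls_eq hp h0
    have h2 := (canonicalForm_spec H).2.walls_eq hp h0
    have h3 := h p hp h0
    exact ⟨h1.1.trans (h3.1.trans h2.1.symm), h1.2.trans (h3.2.trans h2.2.symm)⟩
  refine Prod.ext (Set.ext fun z => ?_) (Set.ext fun z => ?_)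
  · refine exists_congr fun p => and_congr_right fun hp => and_congr_right fun h0 => ?_
    rw [(e p hp h0).1]
  · refine exists_congr fun p => and_congr_right fun hp => and_congr_right fun h0 => ?_
    rw [(e p hp h0).2]

/-! ### Outcomes and killing costs for large heaps -/

/-- `a` exceeds `b` times the golden ratio: for large heaps the owner of `a` wins the heap. -/
def Dominates (a b : ℕ) : Prop := b * b + a * b < a * a

instance (a b : ℕ) : Decidable (Dominates a b) := inferInstanceAs (Decidable (_ < _))

/-- Irrationality of the golden ratio by descent: a solution `(a, c)` with `0 < a` has `c < a` and
yields the smaller solution `(c, a - c)`. -/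
theorem eq_zero_of_golden (a c : ℕ) (h : c * c + a * c = a * a) : a = 0 := by
  induction a using Nat.strong_induction_on generalizing c with
  | _ a ih =>
  by_contra ha
  have hca : c < a := by
    by_contra hle
    have hle : a ≤ c := not_lt.1 hle
    have : a * a ≤ a * c := Nat.mul_le_mul_left a hle
    have : 0 < c * c := Nat.mul_pos (by omega) (by omega)
    omega
  obtain ⟨d, rfl⟩ := Nat.exists_eq_add_of_lt hca
  have := ih c (by omega) (d + 1) (by nlinarith)
  subst this
  nlinarith

theorem Dominates.lt {a b : ℕ} (h : Dominates a b) : b < a := by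
  by_contra hle
  have : a * a ≤ b * b := Nat.mul_le_mul (not_lt.1 hle) (not_lt.1 hle)
  unfold Dominates at h
  omega

theorem Dominates.not_symm {a b : ℕ} (h : Dominates a b) : ¬ Dominates b a := fun h' =>
  absurd h.lt (not_lt.2 h'.lt.le)

theorem dominates_zero {a : ℕ} (ha : 0 < a) : Dominates a 0 := by
  simpa [Dominates] using ha.ne'

/-- From b ≤ φa follows b − a ≤ a/φ, and equality is excluded by irrationality. So a player who is
not dominated becomes dominant by one full move. -/
theorem dominates_sub {a b : ℕ} (ha : 0 < a) (hab : a ≤ b) (h : ¬ Dominates b a) :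
    Dominates a (b - a) := by
  obtain ⟨c, rfl⟩ := Nat.exists_eq_add_of_le hab
  rw [Nat.add_sub_cancel_left]
  unfold Dominates at h ⊢
  have : c * c + a * c ≠ a * a := fun e => ha.ne' (eq_zero_of_golden a c e)
  have : c * c + a * c ≤ a * a := by nlinarith
  omega

/-- If b > φa, then b − i ≥ b − a > a/φ, so no single move of the dominated player reverses the
domination. -/
theorem Dominates.not_sub {a b i : ℕ} (h : Dominates b a) (hi : i ≤ a) :
    ¬ Dominates a (b - i) := by
  intro h'
  have hlt := h.lt
  obtain ⟨c, rfl⟩ := Nat.exists_eq_add_of_lt (lt_of_le_of_lt hi hlt)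
  have e : i + c + 1 - i = c + 1 := by omega
  rw [e] at h'
  unfold Dominates at h h'
  nlinarith

/-- The number of tokens that are wasted until the opponent's wealth `b` is exhausted, if the
owner of `a` moves first. -/
def killCost (a b : ℕ) : ℕ :=
  if b ≤ a ∨ a = 0 then b else b + killCost (2 * a - b) (b - a)
termination_by a + b

theorem killCost_of_le {a b : ℕ} (h : b ≤ a) : killCost a b = b := by
  rw [killCost, if_pos (Or.inl h)]

theorem killCost_of_lt {a b : ℕ} (h : a < b) (ha : 0 < a) :
    killCost a b = b + killCost (2 * a - b) (b - a) := by
  rw [killCost, if_neg (by omega)]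

theorem le_killCost (a b : ℕ) : b ≤ killCost a b := by
  rw [killCost]
  split_ifs <;> omega

theorem killCost_le (a b : ℕ) : killCost a b ≤ 2 * (a + b) := by
  induction hN : a + b using Nat.strong_induction_on generalizing a b with
  | _ N ih =>
  subst hN
  rw [killCost]
  split_ifs with h
  · omega
  · rcases Nat.lt_or_ge (2 * a) b with h1 | h1
    · have : 2 * a - b = 0 := by omega
      rw [this, killCost, if_pos (Or.inr rfl)]
      omega
    · have := ih (2 * a - b + (b - a)) (by omega) _ _ rfl
      omega

/-- A round of full moves by both players takes `(a, b)` to `(2 * a - b, b - a)`. This map fixes the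
ratio b/a = φ, so being at most φ persists; it also gives `b ≤ 2 * a`, so the subtractions are not
truncated. -/
theorem golden_descent {a b : ℕ} (hab : a ≤ b) (h : b * b ≤ a * b + a * a) :
    (b - a) * (b - a) ≤ (2 * a - b) * (b - a) + (2 * a - b) * (2 * a - b) := by
  obtain ⟨c, rfl⟩ := Nat.exists_eq_add_of_le hab
  have hc : c ≤ a := by
    by_contra hlt
    nlinarith
  obtain ⟨d, rfl⟩ := Nat.exists_eq_add_of_le hc
  have e1 : c + d + c - (c + d) = c := by omega
  have e2 : 2 * (c + d) - (c + d + c) = d := by omega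
  rw [e1, e2]
  nlinarith

/-- More wealth for the killer and less for the victim stay so after each round. The hypothesis on
the worse pair `(a', b')` keeps its recursion inside the golden cone, so it never reaches the
truncated values. -/
theorem killCost_mono {a b a' b' : ℕ} (ha : a' ≤ a) (hb : b ≤ b')
    (h : b' * b' ≤ a' * b' + a' * a') : killCost a b ≤ killCost a' b' := by
  induction hN : a + b using Nat.strong_induction_on generalizing a b a' b' with
  | _ N ih =>
  subst hN
  rcases Nat.lt_or_ge a b with h1 | h1
  · have ha' : 0 < a' := by
      rcases Nat.eq_zero_or_pos a' with rfl | h2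
      · have : b' = 0 := by simpa using h
        omega
      · exact h2
    rw [killCost_of_lt h1 (by omega), killCost_of_lt (by omega) ha']
    have hle : b' ≤ 2 * a' := by
      by_contra hlt
      nlinarith
    have := ih (2 * a - b + (b - a)) (by omega) (a := 2 * a - b) (b := b - a)
      (a' := 2 * a' - b') (b' := b' - a') (by omega) (by omega)
      (golden_descent (by omega) h) rfl
    omega
  · rw [killCost_of_le h1]
    exact hb.trans (le_killCost _ _)

/-- The right side is the waste if the killer removes `i`, the victim answers with a full move, and
the killer continues. A smaller `i` leaves the victim richer for the later rounds, so the full move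
wastes least. -/
theorem killCost_le_of_dominates {a b i : ℕ} (hi : i ≤ a) (h : Dominates a (b - i)) :
    killCost a b ≤ i + (b - i + killCost (a - (b - i)) (b - i)) := by
  rcases Nat.lt_or_ge a b with h1 | h1
  · rw [killCost_of_lt h1 (by have := h.lt; omega)]
    have hlt := h.lt
    have : killCost (2 * a - b) (b - a) ≤ killCost (a - (b - i)) (b - i) := by
      refine killCost_mono (by omega) (by omega) ?_
      generalize b - i = c at h hlt ⊢
      obtain ⟨d, rfl⟩ := Nat.exists_eq_add_of_lt hlt
      have e : c + d + 1 - c = d + 1 := by omega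
      rw [e]
      unfold Dominates at h
      nlinarith
    omega
  · rw [killCost_of_le h1]
    omega

theorem killCost_eq {a b : ℕ} (ha : 0 < a) :
    killCost a b = min a b + (b - min a b + killCost (a - (b - min a b)) (b - min a b)) := by
  rcases Nat.lt_or_ge a b with h1 | h1
  · rw [killCost_of_lt h1 ha, min_eq_left h1.le]
    have : a - (b - a) = 2 * a - b := by omega
    rw [this]
    omega
  · rw [killCost_of_le h1, min_eq_right h1, Nat.sub_self, Nat.sub_zero,
      killCost_of_le (Nat.zero_le a)]
    omega

/-- The dominated player, unable to win, wants to waste tokens. The full move both removes the most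
at once and weakens the winner for the later rounds. -/
theorem Dominates.add_killCost_le {a b i : ℕ} (h : Dominates b a) (ha : 0 < a) (hi : i ≤ a) :
    i + killCost (b - i) a ≤ a + killCost (b - a) a := by
  have hlt := h.lt
  rcases Nat.lt_or_ge (b - i) a with h1 | h1
  · rw [killCost_of_lt h1 (by omega),
      killCost_of_lt (a := b - a) (b := a) (by omega) (by omega)]
    have : killCost (2 * (b - i) - a) (a - (b - i)) ≤
        killCost (2 * (b - a) - a) (a - (b - a)) := by
      refine killCost_mono (by omega) (by omega) (golden_descent (by omega) ?_)
      obtain ⟨c, rfl⟩ := Nat.exists_eq_add_of_lt hlt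
      have e : a + c + 1 - a = c + 1 := by omega
      rw [e]
      unfold Dominates at h
      nlinarith
    omega
  · rw [killCost_of_le h1]
    have := le_killCost (b - a) a
    omega

/-! ### The walls for large heaps -/

/-- The Right wall of a heap of large size `n` with wealths `a`, `b`. -/
def bigRight (n a b : ℕ) (p : ℚ) : ℚ :=
  if Dominates a b then n - (b + killCost (a - b) b : ℕ)
  else if Dominates b a then min (-n + a + p) (-n + (a + killCost (b - a) a : ℕ))
  else min (-n + killCost b a + p) ((killCost b a - killCost a b) / 2)

/-- The Left scaffold of a heap of large size `n` with wealths `a`, `b`, below freezing. -/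
def bigScaffold (n a b : ℕ) (p : ℚ) : ℚ :=
  if Dominates b a then -n + (a + killCost (b - a) a : ℕ) else n - killCost a b - p

/-- A bound for the penalties at which `bigScaffold` is correct. -/
def scaffoldBound (n a b : ℕ) : ℚ := if Dominates b a then killCost (b - a) a else n

theorem bigRight_le {n a b i : ℕ} {p : ℚ} (ha : 0 < a) (hn : 20 * (a + b) ≤ n)
    (hp : p ≤ scaffoldBound n a b) (hi : i ≤ a) :
    bigRight (n - i) a (b - i) p - p ≤ bigScaffold n a b p := by
  have hc : ((n - i : ℕ) : ℚ) = n - i := Nat.cast_sub (by omega)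
  have hnq : (20 : ℚ) * (a + b) ≤ n := by exact_mod_cast hn
  have hiq : (i : ℚ) ≤ a := by exact_mod_cast hi
  have hb0 : (0 : ℚ) ≤ b := by positivity
  have ha0 : (0 : ℚ) ≤ a := by positivity
  rw [bigRight, hc, bigScaffold]
  rw [scaffoldBound] at hp
  by_cases hD : Dominates b a
  · rw [if_pos hD] at hp ⊢
    rw [if_neg (hD.not_sub hi)]
    split_ifs with h1
    · have h2 := min_le_left (-((n : ℚ) - i) + a + p)
        (-((n : ℚ) - i) + ((a + killCost (b - i - a) a : ℕ) : ℚ))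
      have h3 : (a : ℚ) ≤ killCost (b - a) a := by exact_mod_cast le_killCost (b - a) a
      push_cast at h2 ⊢
      linarith
    · have h2 := min_le_left (-((n : ℚ) - i) + killCost (b - i) a + p)
        (((killCost (b - i) a : ℚ) - killCost a (b - i)) / 2)
      have h3 : (i : ℚ) + killCost (b - i) a ≤ a + killCost (b - a) a := by
        exact_mod_cast hD.add_killCost_le ha hi
      push_cast
      linarith
  · rw [if_neg hD] at hp ⊢
    have hA : (killCost a b : ℚ) ≤ 2 * (a + b) := by exact_mod_cast killCost_le a b
    -- Only moves that make Left dominant compete. Any other move contributes at most `-n` plus a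
    -- few multiples of `a + b`, whereas the target is at least `-killCost a b` because `p ≤ n`.
    split_ifs with h1 h2
    · have h3 : (killCost a b : ℚ) ≤ i + ((b - i + killCost (a - (b - i)) (b - i) : ℕ) : ℚ) := by
        exact_mod_cast killCost_le_of_dominates hi h1
      linarith
    · have h3 := min_le_right (-((n : ℚ) - i) + a + p)
        (-((n : ℚ) - i) + ((a + killCost (b - i - a) a : ℕ) : ℚ))
      have h4 : ((a + killCost (b - i - a) a : ℕ) : ℚ) ≤ 3 * (a + b) := by
        have := killCost_le (b - i - a) a
        have h5 : a + killCost (b - i - a) a ≤ 3 * (a + b) := by omega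
        exact_mod_cast h5
      linarith
    · have h3 := min_le_left (-((n : ℚ) - i) + killCost (b - i) a + p)
        (((killCost (b - i) a : ℚ) - killCost a (b - i)) / 2)
      have h4 : (killCost (b - i) a : ℚ) ≤ 2 * (a + b) := by
        have := killCost_le (b - i) a
        have h5 : killCost (b - i) a ≤ 2 * (a + b) := by omega
        exact_mod_cast h5
      linarith

theorem bigRight_min_eq {n a b : ℕ} {p : ℚ} (ha : 0 < a) (hn : 20 * (a + b) ≤ n)
    (hp : p ≤ scaffoldBound n a b) :
    bigRight (n - min a b) a (b - min a b) p - p = bigScaffold n a b p := by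
  have hc : ((n - min a b : ℕ) : ℚ) = n - (min a b : ℕ) := Nat.cast_sub (by omega)
  have hnq : (20 : ℚ) * (a + b) ≤ n := by exact_mod_cast hn
  have hb0 : (0 : ℚ) ≤ b := by positivity
  have ha0 : (0 : ℚ) ≤ a := by positivity
  rw [bigRight, hc, bigScaffold]
  rw [scaffoldBound] at hp
  by_cases hD : Dominates b a
  · rw [if_pos hD] at hp ⊢
    have hlt := hD.lt
    have hm : min a b = a := by omega
    rw [hm, if_neg (hD.not_sub le_rfl)]
    split_ifs with h1
    -- Here the bound on `p` is `a`, which does not exceed the freezing point of the option, so the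
    -- sloping branch of its Right wall is the relevant one.
    · have h2 : killCost (b - a) a = a := killCost_of_le h1.lt.le
      have h3 : (a : ℚ) ≤ killCost (b - a - a) a := by exact_mod_cast le_killCost (b - a - a) a
      rw [h2] at hp ⊢
      push_cast
      rw [min_eq_left (by linarith)]
      ring
    · have h4 : (killCost (b - a) a : ℚ) ≤ 2 * (a + b) := by
        have := killCost_le (b - a) a
        have h5 : killCost (b - a) a ≤ 2 * (a + b) := by omega
        exact_mod_cast h5
      have h5 : (killCost a (b - a) : ℚ) ≤ 2 * (a + b) := by
        have := killCost_le a (b - a)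
        have h5 : killCost a (b - a) ≤ 2 * (a + b) := by omega
        exact_mod_cast h5
      have h6 : (0 : ℚ) ≤ killCost (b - a) a := by positivity
      rw [min_eq_left (by linarith)]
      push_cast
      ring
  · rw [if_neg hD]
    have h1 : Dominates a (b - min a b) := by
      rcases le_total a b with h | h
      · rw [min_eq_left h]
        exact dominates_sub ha h hD
      · rw [min_eq_right h, Nat.sub_self]
        exact dominates_zero ha
    rw [if_pos h1]
    have h2 : (killCost a b : ℚ) = (min a b : ℕ) +
        ((b - min a b + killCost (a - (b - min a b)) (b - min a b) : ℕ) : ℚ) := by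
      rw [← Nat.cast_add]
      exact_mod_cast killCost_eq ha
    rw [h2]
    ring

/-- The walls of `G` are those of a heap of large size `n` with wealths `a`, `b`. -/
def HasBigWalls (G : ShortGame) (n a b : ℕ) : Prop :=
  ∀ p, IsDyadic p → 0 ≤ p → lwall G p = - bigRight n b a p ∧ rwall G p = bigRight n a b p

/-- The options of a position of either ruleset, with wealths `a`, `b > 0`. -/
structure IsHeap (G : ShortGame) (n a b : ℕ) : Prop where
  left : ∀ K, G.IsLeftOption K → ∃ i ≤ a, HasBigWalls K (n - i) a (b - i)
  right : ∀ K, G.IsRightOption K → ∃ j ≤ b, HasBigWalls K (n - j) (a - j) b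
  exists_left : ∃ K, G.IsLeftOption K ∧ HasBigWalls K (n - min a b) a (b - min a b)
  exists_right : ∃ K, G.IsRightOption K ∧ HasBigWalls K (n - min b a) (a - min b a) b

theorem IsHeap.hasOptions {G : ShortGame} {n a b : ℕ} (h : IsHeap G n a b) : HasOptions G := by
  obtain ⟨K, hK, -⟩ := h.exists_left
  obtain ⟨K', hK', -⟩ := h.exists_right
  exact ⟨⟨K, hK⟩, K', hK'⟩

theorem IsHeap.lcand_eq {G : ShortGame} {n a b : ℕ} {p : ℚ} (h : IsHeap G n a b) (ha : 0 < a)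
    (hn : 20 * (a + b) ≤ n) (hp : IsDyadic p) (h0 : 0 ≤ p) (hpb : p ≤ scaffoldBound n a b) :
    lcand G p = bigScaffold n a b p := by
  apply le_antisymm
  · obtain ⟨K, hK, e⟩ := h.hasOptions.exists_lcand_eq p
    obtain ⟨i, hi, hw⟩ := h.left K hK
    rw [e, (hw p hp h0).2]
    exact bigRight_le ha hn hpb hi
  · obtain ⟨K, hK, hw⟩ := h.exists_left
    rw [← bigRight_min_eq ha hn hpb, ← (hw p hp h0).2]
    exact hK.le_lcand p

theorem IsHeap.rcand_eq {G : ShortGame} {n a b : ℕ} {p : ℚ} (h : IsHeap G n a b) (hb : 0 < b)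
    (hn : 20 * (a + b) ≤ n) (hp : IsDyadic p) (h0 : 0 ≤ p) (hpb : p ≤ scaffoldBound n b a) :
    rcand G p = - bigScaffold n b a p := by
  have hn' : 20 * (b + a) ≤ n := by omega
  apply le_antisymm
  · obtain ⟨K, hK, hw⟩ := h.exists_right
    rw [← bigRight_min_eq hb hn' hpb]
    have h1 := hK.rcand_le p
    rw [(hw p hp h0).1] at h1
    linarith
  · obtain ⟨K, hK, e⟩ := h.hasOptions.exists_rcand_eq p
    obtain ⟨i, hi, hw⟩ := h.right K hK
    rw [e, (hw p hp h0).1]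
    have := bigRight_le hb hn' hpb hi
    linarith

/-- The greedy option attains both scaffolds and no other option beats it, so it remains to locate
their meeting point. When one side dominates, one scaffold is constant and the meeting point is the
extra waste incurred by the winner when the loser starts. When neither does, both scaffolds slope
and meet high up, near `n`. -/
theorem IsHeap.hasBigWalls {G : ShortGame} {n a b : ℕ} (h : IsHeap G n a b) (ha : 0 < a)
    (hb : 0 < b) (hn : 20 * (a + b) ≤ n) : HasBigWalls G n a b := by
  have hnq : (20 : ℚ) * (a + b) ≤ n := by exact_mod_cast hn
  have hb0 : (0 : ℚ) < b := by exact_mod_cast hb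
  have ha0 : (0 : ℚ) < a := by exact_mod_cast ha
  -- The scaffold formulas hold only up to `scaffoldBound`, which suffices as soon as the meeting
  -- point lies below both bounds.
  have key : ∀ t, IsDyadic t → 0 ≤ t → t ≤ scaffoldBound n a b → t ≤ scaffoldBound n b a →
      (∀ q, 0 ≤ q → q < t → - bigScaffold n b a q < bigScaffold n a b q) →
      bigScaffold n a b t = - bigScaffold n b a t →
      ∀ p, IsDyadic p → 0 ≤ p → lwall G p = bigScaffold n a b (min p t) ∧
        rwall G p = - bigScaffold n b a (min p t) := by
    intro t ht ht0 h1 h2 hlt heq p hp hp0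
    have hT : IsTemp G t := by
      refine ⟨ht, ht0, fun q hq hq0 hqt => ?_, ?_⟩
      · rw [h.lcand_eq ha hn hq hq0 (by linarith), h.rcand_eq hb hn hq hq0 (by linarith)]
        exact hlt q hq0 hqt
      · rw [h.lcand_eq ha hn ht ht0 h1, h.rcand_eq hb hn ht ht0 h2, heq]
    have hm := min_le_right p t
    have e := hT.walls h.hasOptions hp hp0
    rwa [h.lcand_eq ha hn (hp.min ht) (le_min hp0 ht0) (by linarith),
      h.rcand_eq hb hn (hp.min ht) (le_min hp0 ht0) (by linarith)] at e
  intro p hp hp0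
  by_cases hab : Dominates a b
  · have hba := hab.not_symm
    have h1 : killCost a b = b := killCost_of_le hab.lt.le
    have h2 : (killCost (a - b) b : ℚ) ≤ 2 * (a + b) := by
      have := killCost_le (a - b) b
      have h5 : killCost (a - b) b ≤ 2 * (a + b) := by omega
      exact_mod_cast h5
    simp only [bigScaffold, scaffoldBound, if_pos hab, if_neg hba, h1] at key
    have e := key (killCost (a - b) b) (isDyadic_natCast _) (by positivity) (by linarith) le_rfl
      (fun q _ hq => by push_cast; linarith) (by push_cast; ring) p hp hp0
    rw [e.1, e.2]
    simp only [bigRight, if_pos hab, if_neg hba]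
    refine ⟨?_, by ring⟩
    push_cast
    rcases le_total p (killCost (a - b) b) with h3 | h3
    · rw [min_eq_left h3, min_eq_left (by linarith)]
      ring
    · rw [min_eq_right h3, min_eq_right (by linarith)]
      ring
  by_cases hba : Dominates b a
  · have h1 : killCost b a = a := killCost_of_le hba.lt.le
    have h2 : (killCost (b - a) a : ℚ) ≤ 2 * (a + b) := by
      have := killCost_le (b - a) a
      have h5 : killCost (b - a) a ≤ 2 * (a + b) := by omega
      exact_mod_cast h5
    simp only [bigScaffold, scaffoldBound, if_pos hba, if_neg hab, h1] at key
    have e := key (killCost (b - a) a) (isDyadic_natCast _) (by positivity) le_rfl (by linarith)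
      (fun q _ hq => by push_cast; linarith) (by push_cast; ring) p hp hp0
    rw [e.1, e.2]
    simp only [bigRight, if_pos hba, if_neg hab]
    refine ⟨by ring, ?_⟩
    push_cast
    rcases le_total p (killCost (b - a) a) with h3 | h3
    · rw [min_eq_left h3, min_eq_left (by linarith)]
      ring
    · rw [min_eq_right h3, min_eq_right (by linarith)]
      ring
  · have h1 : (killCost a b : ℚ) ≤ 2 * (a + b) := by exact_mod_cast killCost_le a b
    have h2 : (killCost b a : ℚ) ≤ 2 * (b + a) := by exact_mod_cast killCost_le b a
    have h3 : (0 : ℚ) ≤ killCost a b := by positivity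
    have h4 : (0 : ℚ) ≤ killCost b a := by positivity
    simp only [bigScaffold, scaffoldBound, if_neg hba, if_neg hab] at key
    have e := key (n - (killCost a b + killCost b a) / 2)
      ((isDyadic_natCast _).sub ((isDyadic_natCast _).add (isDyadic_natCast _)).div_two)
      (by linarith) (by linarith) (by linarith) (fun q _ hq => by linarith) (by ring) p hp hp0
    rw [e.1, e.2]
    simp only [bigRight, if_neg hba, if_neg hab]
    rcases le_total p (n - (killCost a b + killCost b a) / 2) with h5 | h5
    · rw [min_eq_left h5, min_eq_left (by linarith), min_eq_left (by linarith)]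
      constructor <;> ring
    · rw [min_eq_right h5, min_eq_right (by linarith), min_eq_right (by linarith)]
      constructor <;> ring

/-! ### The rulesets -/

theorem isLeftOption_robinHood {n a b : ℕ} {K : ShortGame} :
    (robinHood n a b).IsLeftOption K ↔
      ∃ i, 1 ≤ i ∧ i ≤ n ∧ i ≤ a ∧ K = robinHood (n - i) a (b - i) := by
  rw [robinHood]
  constructor
  · rintro ⟨i, rfl⟩
    have := i.isLt
    exact ⟨i + 1, by omega, by omega, by omega, rfl⟩
  · rintro ⟨i, h1, h2, h3, rfl⟩
    refine ⟨⟨i - 1, by omega⟩, ?_⟩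
    simp only [Nat.sub_add_cancel h1]

theorem isRightOption_robinHood {n a b : ℕ} {K : ShortGame} :
    (robinHood n a b).IsRightOption K ↔
      ∃ j, 1 ≤ j ∧ j ≤ n ∧ j ≤ b ∧ K = robinHood (n - j) (a - j) b := by
  rw [robinHood]
  constructor
  · rintro ⟨i, rfl⟩
    have := i.isLt
    exact ⟨i + 1, by omega, by omega, by omega, rfl⟩
  · rintro ⟨i, h1, h2, h3, rfl⟩
    refine ⟨⟨i - 1, by omega⟩, ?_⟩
    simp only [Nat.sub_add_cancel h1]

/-- On such a heap the size does not limit the move. The Right option is written with `min b a` to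
match the symmetric form of `IsHeap`. -/
theorem littleJohn_eq {n a b : ℕ} (hn : a + b ≤ n) (ha : 0 < a) (hb : 0 < b) :
    littleJohn n a b = mk ![littleJohn (n - min a b) a (b - min a b)]
      ![littleJohn (n - min b a) (a - min b a) b] := by
  rw [littleJohn, if_neg (by omega), if_neg (by omega), if_neg (by omega)]
  have : min n (min a b) = min a b := by omega
  rw [this, min_comm b a]

theorem littleJohn_zero_right {n a : ℕ} (ha : 0 < a) : littleJohn n a 0 = natGame n := by
  induction n with
  | zero => rw [littleJohn, if_pos (Or.inl rfl), natGame]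
  | succ n ih => rw [littleJohn, if_neg (by omega), if_pos rfl, Nat.add_sub_cancel, ih, natGame]

theorem littleJohn_zero_left {n b : ℕ} (hb : 0 < b) : littleJohn n 0 b = negNatGame n := by
  induction n with
  | zero => rw [littleJohn, if_pos (Or.inl rfl), negNatGame]
  | succ n ih =>
    rw [littleJohn, if_neg (by omega), if_neg (by omega), if_pos rfl, Nat.add_sub_cancel, ih,
      negNatGame]

/-- Every remaining token is a free move for Left, and removing one token at a time loses none of
them. -/
theorem robinHood_zero_right_equal {n a : ℕ} (ha : 0 < a) :
    Equal (robinHood n a 0) (ratGame n) := by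
  induction n using Nat.strong_induction_on with
  | _ n ih =>
  refine ⟨le_iff.2 ⟨fun K hK h => ?_, fun K hK => ?_⟩,
    le_iff.2 ⟨fun K hK h => ?_, fun K hK => ?_⟩⟩
  · obtain ⟨i, h1, h2, h3, rfl⟩ := isLeftOption_robinHood.1 hK
    rw [Nat.zero_sub] at h
    have := (ratGame_le_iff (isDyadic_natCast _) (isDyadic_natCast _)).1
      (le_trans _ _ _ h (ih (n - i) (by omega)).1)
    have : n ≤ n - i := by exact_mod_cast this
    omega
  · obtain ⟨h | h, -⟩ := (isRightOption_ratGame (isDyadic_natCast n)).1 hK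
    · simp at h
    · exact absurd h (not_lt.2 (by positivity))
  · obtain ⟨h1, rfl⟩ := (isLeftOption_ratGame (isDyadic_natCast n)).1 hK
    have hn : 0 < n := by simpa using h1
    have h2 : ((n : ℚ) - 1 / ((n : ℚ).den : ℚ)) = (n - 1 : ℕ) := by
      rw [Rat.den_natCast, Nat.cast_sub hn]
      simp
    rw [h2] at h
    exact (isLeftOption_robinHood.2 ⟨1, le_rfl, hn, ha, rfl⟩).not_le
      (le_trans _ _ _ h (ih (n - 1) (by omega)).2)
  · obtain ⟨j, h1, -, h3, -⟩ := isRightOption_robinHood.1 hK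
    omega

theorem robinHood_zero_left_equal {n b : ℕ} (hb : 0 < b) :
    Equal (robinHood n 0 b) (ratGame (-n)) := by
  induction n using Nat.strong_induction_on with
  | _ n ih =>
  have d : ∀ k : ℕ, IsDyadic (-(k : ℚ)) := fun k => (isDyadic_natCast k).neg
  refine ⟨le_iff.2 ⟨fun K hK h => ?_, fun K hK h => ?_⟩,
    le_iff.2 ⟨fun K hK h => ?_, fun K hK h => ?_⟩⟩
  · obtain ⟨j, h1, -, h3, -⟩ := isLeftOption_robinHood.1 hK
    omega
  · obtain ⟨h1, rfl⟩ := (isRightOption_ratGame (d n)).1 hK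
    have hn : 0 < n := by simpa using h1
    have h2 : (-(n : ℚ) + 1 / ((-(n : ℚ)).den : ℚ)) = -(n - 1 : ℕ) := by
      rw [Rat.den_neg_eq_den, Rat.den_natCast, Nat.cast_sub hn]
      push_cast
      ring
    rw [h2] at h
    exact (isRightOption_robinHood.2 ⟨1, le_rfl, hn, hb, rfl⟩).not_le
      (le_trans _ _ _ (ih (n - 1) (by omega)).1 h)
  · obtain ⟨h1 | h1, -⟩ := (isLeftOption_ratGame (d n)).1 hK
    · simp at h1
    · have : (0 : ℚ) ≤ n := by positivity
      linarith
  · obtain ⟨i, h1, h2, h3, rfl⟩ := isRightOption_robinHood.1 hK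
    rw [Nat.zero_sub] at h
    have := (ratGame_le_iff (d _) (d _)).1 (le_trans _ _ _ (ih (n - i) (by omega)).2 h)
    have : n ≤ n - i := by exact_mod_cast neg_le_neg_iff.1 this
    omega

/-! ### Large-heap walls for both rulesets, by induction on the total wealth. -/

theorem hasBigWalls_of_equal_natCast {G : ShortGame} {n a : ℕ} (ha : 0 < a)
    (h : Equal G (ratGame n)) : HasBigWalls G n a 0 := by
  intro p _ hp0
  have e := EqualsDyadic.walls (p := p) ⟨isDyadic_natCast n, h⟩ hp0
  have hD := dominates_zero ha
  rw [e.1, e.2, bigRight, if_neg hD.not_symm, if_pos hD, bigRight, if_pos hD,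
    killCost_of_le (Nat.zero_le _)]
  refine ⟨?_, by simp⟩
  rw [min_eq_right (by push_cast; linarith)]
  simp

theorem hasBigWalls_of_equal_neg_natCast {G : ShortGame} {n b : ℕ} (hb : 0 < b)
    (h : Equal G (ratGame (-n))) : HasBigWalls G n 0 b := by
  intro p _ hp0
  have e := EqualsDyadic.walls (p := p) ⟨(isDyadic_natCast n).neg, h⟩ hp0
  have hD := dominates_zero hb
  rw [e.1, e.2, bigRight, if_pos hD, bigRight, if_neg hD.not_symm, if_pos hD,
    killCost_of_le (Nat.zero_le _)]
  refine ⟨by simp, ?_⟩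
  rw [min_eq_right (by push_cast; linarith)]
  simp

theorem exists_hasBigWalls (s : ℕ) : ∃ N, ∀ a b n : ℕ, 0 < a + b → a + b ≤ s → N ≤ n →
    HasBigWalls (robinHood n a b) n a b ∧ HasBigWalls (littleJohn n a b) n a b := by
  induction s with
  | zero => exact ⟨0, fun a b n h1 h2 => by omega⟩
  | succ s ih =>
    obtain ⟨N, hN⟩ := ih
    -- A move removes at most `s + 1` tokens, so the options still have heaps of size at least `N`;
    -- the term `20 * (s + 1)` also supplies the size needed by `IsHeap.hasBigWalls`. Each move
    -- lowers the total wealth but not the mover's own, so `(0, 0)` is not reached.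
    refine ⟨N + 20 * (s + 1), fun a b n h1 h2 hn => ?_⟩
    rcases Nat.eq_zero_or_pos b with rfl | hb
    · have ha : 0 < a := by omega
      refine ⟨hasBigWalls_of_equal_natCast ha (robinHood_zero_right_equal ha),
        hasBigWalls_of_equal_natCast ha ?_⟩
      rw [littleJohn_zero_right ha, ratGame_natCast]
      exact Equal.refl _
    rcases Nat.eq_zero_or_pos a with rfl | ha
    · refine ⟨hasBigWalls_of_equal_neg_natCast hb (robinHood_zero_left_equal hb),
        hasBigWalls_of_equal_neg_natCast hb ?_⟩
      rw [littleJohn_zero_left hb, ratGame_neg_natCast]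
      exact Equal.refl _
    have hl : ∀ i, 1 ≤ i → i ≤ a → _ := fun i hi1 hi =>
      hN a (b - i) (n - i) (by omega) (by omega) (by omega)
    have hr : ∀ j, 1 ≤ j → j ≤ b → _ := fun j hj1 hj =>
      hN (a - j) b (n - j) (by omega) (by omega) (by omega)
    constructor
    · refine IsHeap.hasBigWalls ⟨fun K hK => ?_, fun K hK => ?_, ?_, ?_⟩ ha hb (by omega)
      · obtain ⟨i, h1, -, h3, rfl⟩ := isLeftOption_robinHood.1 hK
        exact ⟨i, h3, (hl i h1 h3).1⟩
      · obtain ⟨i, h1, -, h3, rfl⟩ := isRightOption_robinHood.1 hK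
        exact ⟨i, h3, (hr i h1 h3).1⟩
      · exact ⟨_, isLeftOption_robinHood.2
          ⟨min a b, by omega, by omega, by omega, rfl⟩, (hl _ (by omega) (by omega)).1⟩
      · exact ⟨_, isRightOption_robinHood.2
          ⟨min b a, by omega, by omega, by omega, rfl⟩, (hr _ (by omega) (by omega)).1⟩
    · have eL := (hl (min a b) (by omega) (by omega)).2
      have eR := (hr (min b a) (by omega) (by omega)).2
      rw [littleJohn_eq (by omega) ha hb]
      refine IsHeap.hasBigWalls ⟨?_, ?_, ⟨_, ⟨0, rfl⟩, eL⟩, ⟨_, ⟨0, rfl⟩, eR⟩⟩ ha hb (by omega)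
      · rintro K ⟨i, rfl⟩
        rw [Fin.fin_one_eq_zero i]
        exact ⟨_, by omega, eL⟩
      · rintro K ⟨i, rfl⟩
        rw [Fin.fin_one_eq_zero i]
        exact ⟨_, by omega, eR⟩

theorem robinHood_zero_zero_equal (n : ℕ) : Equal (robinHood n 0 0) (littleJohn n 0 0) := by
  rw [littleJohn, if_pos (Or.inr ⟨rfl, rfl⟩)]
  refine ⟨le_iff.2 ⟨fun K hK => ?_, fun K hK => absurd hK (not_isRightOption_zero K)⟩,
    le_iff.2 ⟨fun K hK => absurd hK (not_isLeftOption_zero K), fun K hK => ?_⟩⟩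
  · obtain ⟨i, h1, -, h3, -⟩ := isLeftOption_robinHood.1 hK
    omega
  · obtain ⟨i, h1, -, h3, -⟩ := isRightOption_robinHood.1 hK
    omega

end ShortGame

theorem mainTheorem2 (a b : ℕ) :
    ∃ N : ℕ, ∀ n : ℕ, N ≤ n →
      ShortGame.thermograph (ShortGame.robinHood n a b) =
        ShortGame.thermograph (ShortGame.littleJohn n a b) := by
  -- Without any wealth both games are zero. The wall formulas fail there, since they would describe
  -- a contested heap, so this case is separate.
  rcases Nat.eq_zero_or_pos (a + b) with h | h
  · obtain ⟨rfl, rfl⟩ : a = 0 ∧ b = 0 := by omega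
    exact ⟨0, fun n _ => ShortGame.thermograph_eq_of_walls_eq fun p hp h0 =>
      (ShortGame.robinHood_zero_zero_equal n).walls_eq hp h0⟩
  · obtain ⟨N, hN⟩ := ShortGame.exists_hasBigWalls (a + b)
    refine ⟨N, fun n hn => ShortGame.thermograph_eq_of_walls_eq fun p hp h0 => ?_⟩
    obtain ⟨h1, h2⟩ := hN a b n h le_rfl hn
    rw [(h1 p hp h0).1, (h1 p hp h0).2, (h2 p hp h0).1, (h2 p hp h0).2]
    exact ⟨rfl, rfl⟩
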